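/- **Setting.** A seller owns one item and a buyer wants it. The buyer's value $v$ and the seller's value $c$ are private and independent, $v\sim F$ and $c\sim G$, where $F$ and $G$ are Borel probability measures on $\mathbb{R}$ concentrated on bounded subsets of $[0,\infty)$ (no further assumption on $F$ and $G$ is made). A *mechanism* $M=(x,p,\tilde p)$ consists of measurable functions of the bids $(v,c)\in\mathbb{R}_+^2$: the allocation $x(v,c)\in[0,1]$, the buyer's payment $p(v,c)\ge 0$ and the amount $\tilde p(v,c)\ge 0$ received by the seller, with finite expected payments, both overall and conditionally on each nonnegative bid of the paying or receiving trader. The buyer of value $v$ has utility $v\,x-p$ and the seller of value $c$ has utility $\tilde p-c\,x$. Let $\mathfrak{M}_{F,G}$ be the set of mechanisms which are * Bayesian incentive compatible: for every $v\in\operatorname{supp}F$ and every $c\in\operatorname{supp}G$, bidding the true value maximizes the trader's interim expected utility over all nonnegative bids when the other trader bids truthfully; * interim individually rational: for every $v\in\operatorname{supp}F$ and every $c\in\operatorname{supp}G$, the truthful interim expected utility is nonnegative; * ex ante weakly budget balanced: $\mathbb{E}[\tilde p(v,c)]\le\mathbb{E}[p(v,c)]$. Put $U(M)=\mathbb{E}[v\,x(v,c)-p(v,c)]$,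 $\Pi(M)=\mathbb{E}[\tilde p(v,c)-c\,x(v,c)]$ and $\mathrm{GFT}(M)=\mathbb{E}[(v-c)\,x(v,c)]$. The ideal utilities are $U^*=\sup_{M\in\mathfrak{M}_{F,G}}U(M)$ and $\Pi^*=\sup_{M\in\mathfrak{M}_{F,G}}\Pi(M)$, and the second-best benchmark is $\mathrm{OPT}_{SB}=\sup_{M\in\mathfrak{M}_{F,G}}\mathrm{GFT}(M)$. A mechanism $M$ is *KS-fair* if $M\in\mathfrak{M}_{F,G}$ and $$\frac{\Pi(M)}{\Pi^*}=\frac{U(M)}{U^*},$$ where $0/0$ is read as $0$ (this occurs only in instances without gains from trade, where $\Pi^*=U^*=0$). In the *Seller Offer Mechanism* the seller of value $c$ offers a price $\sigma(c)\ge0$, where $\sigma$ is measurable and $\sigma(c)\in\arg\max_{p\ge0}(p-c)\Pr[v\ge p]$ for every $c\in\operatorname{supp}G$; trade takes place at that price if and only if $v\ge\sigma(c)$. In the *Buyer Offer Mechanism* the buyer of value $v$ offers a price $\beta(v)\ge0$, where $\beta$ is measurable and $\beta(v)\in\arg\max_{p\ge0}(v-p)\Pr[c\le p]$ for every $v\in\operatorname{supp}F$;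 trade takes place at that price if and only if $c\le\beta(v)$. For $\lambda\in[0,1]$ the *$\lambda$-Biased Random Offer Mechanism* runs the Seller Offer Mechanism with probability $\lambda$ and the Buyer Offer Mechanism with probability $1-\lambda$ (its allocation and payments are the corresponding expectations). **Theorem.** For every such pair $(F,G)$, optimal measurable price functions $\sigma$ and $\beta$ exist; and for every choice of them there is $\lambda\in[0,1]$ such that the $\lambda$-Biased Random Offer Mechanism is KS-fair and $$\mathrm{GFT}(\lambda\text{-Biased Random Offer Mechanism})\ \ge\ \tfrac12\,\mathrm{OPT}_{SB}.$$ -/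

import Mathlib

open MeasureTheory Set

noncomputable section

namespace BilateralTrade

/-- The prior of a trader's value: a Borel probability measure on the line which is concentrated
on a bounded set of nonnegative numbers. -/
structure IsPrior (μ : Measure ℝ) : Prop where
  isProbabilityMeasure : IsProbabilityMeasure μ
  bounded : ∃ b : ℝ, μ (Icc 0 b)ᶜ = 0

/-- A direct mechanism `(x, p, p̃)`. The first argument is the bid `v` of the buyer and the second
one the bid `c` of the seller. Bids are nonnegative: what the functions do at negative arguments
enters none of the notions below. -/
structure Mechanism where
  /-- the allocation `x(v, c)` -/
  alloc : ℝ → ℝ → ℝ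
  /-- the payment `p(v, c)` made by the buyer -/
  buyerPay : ℝ → ℝ → ℝ
  /-- the payment `p̃(v, c)` received by the seller -/
  sellerPay : ℝ → ℝ → ℝ
  measurable_alloc : Measurable (Function.uncurry alloc)
  measurable_buyerPay : Measurable (Function.uncurry buyerPay)
  measurable_sellerPay : Measurable (Function.uncurry sellerPay)
  alloc_mem : ∀ v c, alloc v c ∈ Icc (0 : ℝ) 1
  buyerPay_nonneg : ∀ v c, 0 ≤ buyerPay v c
  sellerPay_nonneg : ∀ v c, 0 ≤ sellerPay v c

/-- Interim utility of a buyer of value `v` who bids `r` against a truthful seller of prior `G`. -/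
def buyerInterim (G : Measure ℝ) (M : Mechanism) (v r : ℝ) : ℝ :=
  ∫ c, (v * M.alloc r c - M.buyerPay r c) ∂G

/-- Interim utility of a seller of value `c` who bids `r` against a truthful buyer of prior `F`. -/
def sellerInterim (F : Measure ℝ) (M : Mechanism) (c r : ℝ) : ℝ :=
  ∫ v, (M.sellerPay v r - c * M.alloc v r) ∂F

/-- Ex ante utility `U(M)` of the buyer. -/
def buyerUtility (F G : Measure ℝ) (M : Mechanism) : ℝ :=
  ∫ v, buyerInterim G M v v ∂F

/-- Ex ante utility `Π(M)` of the seller. -/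
def sellerUtility (F G : Measure ℝ) (M : Mechanism) : ℝ :=
  ∫ c, sellerInterim F M c c ∂G

/-- Expected gains from trade. -/
def gft (F G : Measure ℝ) (M : Mechanism) : ℝ :=
  ∫ z : ℝ × ℝ, (z.1 - z.2) * M.alloc z.1 z.2 ∂(F.prod G)

/-- The family of mechanisms that are Bayesian incentive compatible, interim individually rational
and ex ante weakly budget balanced. Incentive compatibility and individual rationality are imposed
at every value in the support of the prior, against every nonnegative bid. The first four fields
say that the expected payments occurring in these conditions are finite. -/
structure IsTruthful (F G : Measure ℝ) (M : Mechanism) : Prop where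
  integrable_buyerPay : Integrable (Function.uncurry M.buyerPay) (F.prod G)
  integrable_sellerPay : Integrable (Function.uncurry M.sellerPay) (F.prod G)
  integrable_buyerPay_bid : ∀ r : ℝ, 0 ≤ r → Integrable (fun c => M.buyerPay r c) G
  integrable_sellerPay_bid : ∀ r : ℝ, 0 ≤ r → Integrable (fun v => M.sellerPay v r) F
  buyer_ic : ∀ v ∈ F.support, ∀ r : ℝ, 0 ≤ r → buyerInterim G M v r ≤ buyerInterim G M v v
  seller_ic : ∀ c ∈ G.support, ∀ r : ℝ, 0 ≤ r → sellerInterim F M c r ≤ sellerInterim F M c c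
  buyer_ir : ∀ v ∈ F.support, 0 ≤ buyerInterim G M v v
  seller_ir : ∀ c ∈ G.support, 0 ≤ sellerInterim F M c c
  budget : ∫ c, ∫ v, M.sellerPay v c ∂F ∂G ≤ ∫ v, ∫ c, M.buyerPay v c ∂G ∂F

/-- The second-best benchmark. -/
def secondBest (F G : Measure ℝ) : ℝ := sSup (gft F G '' {M | IsTruthful F G M})

/-- Ideal utility `U*` of the buyer. -/
def buyerIdeal (F G : Measure ℝ) : ℝ := sSup (buyerUtility F G '' {M | IsTruthful F G M})

/-- Ideal utility `Π*` of the seller. -/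
def sellerIdeal (F G : Measure ℝ) : ℝ := sSup (sellerUtility F G '' {M | IsTruthful F G M})

/-! The three suprema above are taken over nonempty sets that are bounded above. -/

/-- The mechanism without trade and without payments. -/
def noTrade : Mechanism where
  alloc _ _ := 0
  buyerPay _ _ := 0
  sellerPay _ _ := 0
  measurable_alloc := measurable_const
  measurable_buyerPay := measurable_const
  measurable_sellerPay := measurable_const
  alloc_mem _ _ := by simp
  buyerPay_nonneg _ _ := le_rfl
  sellerPay_nonneg _ _ := le_rfl

theorem isTruthful_noTrade (F G : Measure ℝ) : IsTruthful F G noTrade := by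
  constructor <;>
    simp [noTrade, buyerInterim, sellerInterim, Function.uncurry_def]

theorem integral_le_of_ae_le {α : Type*} [MeasurableSpace α] {μ : Measure α}
    [IsProbabilityMeasure μ] {f : α → ℝ} {b : ℝ} (hb : 0 ≤ b) (h : ∀ᵐ x ∂μ, f x ≤ b) :
    ∫ x, f x ∂μ ≤ b := by
  by_cases hf : Integrable f μ
  · simpa using integral_mono_ae hf (integrable_const b) h
  · rw [integral_undef hf]
    exact hb

theorem IsPrior.exists_bound {μ : Measure ℝ} (h : IsPrior μ) :
    ∃ b : ℝ, 0 ≤ b ∧ ∀ᵐ x ∂μ, 0 ≤ x ∧ x ≤ b := by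
  obtain ⟨b, hb⟩ := h.bounded
  refine ⟨max b 0, le_max_right _ _, ?_⟩
  have hx : ∀ᵐ x ∂μ, x ∈ Icc 0 b := mem_ae_iff.2 hb
  filter_upwards [hx] with x hx
  exact ⟨hx.1, hx.2.trans (le_max_left _ _)⟩

theorem bddAbove_gft {F G : Measure ℝ} (hF : IsPrior F) (hG : IsPrior G) :
    BddAbove (gft F G '' {M | IsTruthful F G M}) := by
  have := hF.isProbabilityMeasure
  have := hG.isProbabilityMeasure
  obtain ⟨b, hb, hFb⟩ := hF.exists_bound
  obtain ⟨d, -, hGd⟩ := hG.exists_bound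
  refine ⟨b, ?_⟩
  rintro _ ⟨M, -, rfl⟩
  refine integral_le_of_ae_le hb ?_
  filter_upwards [Measure.quasiMeasurePreserving_fst.ae hFb,
    Measure.quasiMeasurePreserving_snd.ae hGd] with z hz hz'
  have hx := M.alloc_mem z.1 z.2
  nlinarith [mul_nonneg hz'.1 hx.1, mul_nonneg hz.1 (sub_nonneg.2 hx.2), hz.2]

theorem bddAbove_buyerUtility {F G : Measure ℝ} (hF : IsPrior F) (hG : IsPrior G) :
    BddAbove (buyerUtility F G '' {M | IsTruthful F G M}) := by
  have := hF.isProbabilityMeasure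
  have := hG.isProbabilityMeasure
  obtain ⟨b, hb, hFb⟩ := hF.exists_bound
  refine ⟨b, ?_⟩
  rintro _ ⟨M, -, rfl⟩
  refine integral_le_of_ae_le hb ?_
  filter_upwards [hFb] with v hv
  refine integral_le_of_ae_le hb (ae_of_all _ fun c => ?_)
  have hx := M.alloc_mem v c
  nlinarith [mul_nonneg hv.1 (sub_nonneg.2 hx.2), hv.2, M.buyerPay_nonneg v c]

theorem bddAbove_sellerUtility {F G : Measure ℝ} (hF : IsPrior F) (hG : IsPrior G) :
    BddAbove (sellerUtility F G '' {M | IsTruthful F G M}) := by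
  have := hF.isProbabilityMeasure
  have := hG.isProbabilityMeasure
  obtain ⟨b, hb, hFb⟩ := hF.exists_bound
  obtain ⟨d, -, hGd⟩ := hG.exists_bound
  refine ⟨b, ?_⟩
  rintro _ ⟨M, hM, rfl⟩
  have h1 : sellerUtility F G M ≤ ∫ c, ∫ v, M.sellerPay v c ∂F ∂G := by
    refine integral_mono_of_nonneg ?_ hM.integrable_sellerPay.integral_prod_right ?_
    · filter_upwards [G.support_mem_ae] with c hc using hM.seller_ir c hc
    · filter_upwards [G.support_mem_ae, hGd] with c hc hcd
      by_cases hi : Integrable (fun v => M.sellerPay v c - c * M.alloc v c) F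
      · refine integral_mono hi (hM.integrable_sellerPay_bid c hcd.1) fun v => ?_
        have := mul_nonneg hcd.1 (M.alloc_mem v c).1
        simpa using this
      · simp only [sellerInterim, integral_undef hi]
        exact integral_nonneg fun v => M.sellerPay_nonneg v c
  refine h1.trans (hM.budget.trans (integral_le_of_ae_le hb ?_))
  filter_upwards [F.support_mem_ae, hFb] with v hv hvb
  have hp := hM.integrable_buyerPay_bid v hvb.1
  have hx : Integrable (fun c => v * M.alloc v c) G := by
    refine Integrable.const_mul ?_ v
    refine Integrable.of_bound (C := 1)
      (M.measurable_alloc.comp measurable_prodMk_left).aestronglyMeasurable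
      (ae_of_all _ fun c => ?_)
    have hx := M.alloc_mem v c
    simpa [abs_of_nonneg hx.1] using hx.2
  have h2 := hM.buyer_ir v hv
  rw [buyerInterim, integral_sub hx hp] at h2
  have h3 : ∫ c, v * M.alloc v c ∂G ≤ b := integral_le_of_ae_le hb (ae_of_all _ fun c => by
    have hx := M.alloc_mem v c
    nlinarith [mul_nonneg hvb.1 (sub_nonneg.2 hx.2), hvb.2])
  linarith

/-- KS-fairness. The two ideal utilities can vanish only together, in an instance without gains
from trade; then every truthful mechanism gives both traders utility zero and counts as fair. -/
structure IsKSFair (F G : Measure ℝ) (M : Mechanism) : Prop where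
  truthful : IsTruthful F G M
  fair : sellerUtility F G M / sellerIdeal F G = buyerUtility F G M / buyerIdeal F G

/-- A pricing strategy of the seller: at each value `c` in the support of `G` the offer `price c`
maximizes the expected profit `(p - c) * P(v ≥ p)` over all prices `p`. -/
structure SellerOffer (F G : Measure ℝ) where
  price : ℝ → ℝ
  measurable_price : Measurable price
  price_nonneg : ∀ c, 0 ≤ price c
  optimal : ∀ c ∈ G.support, ∀ p : ℝ, 0 ≤ p →
    (p - c) * F.real (Ici p) ≤ (price c - c) * F.real (Ici (price c))

/-- A pricing strategy of the buyer: at each value `v` in the support of `F` the offer `price v`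
maximizes the expected surplus `(v - p) * P(c ≤ p)` over all prices `p`. -/
structure BuyerOffer (F G : Measure ℝ) where
  price : ℝ → ℝ
  measurable_price : Measurable price
  price_nonneg : ∀ v, 0 ≤ price v
  optimal : ∀ v ∈ F.support, ∀ p : ℝ, 0 ≤ p →
    (v - p) * G.real (Iic p) ≤ (v - price v) * G.real (Iic (price v))

/-- The seller-offer mechanism: trade at the price offered by the seller if the buyer's value is
at least that price. -/
def SellerOffer.mechanism {F G : Measure ℝ} (s : SellerOffer F G) : Mechanism where
  alloc v c := if s.price c ≤ v then 1 else 0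
  buyerPay v c := if s.price c ≤ v then s.price c else 0
  sellerPay v c := if s.price c ≤ v then s.price c else 0
  measurable_alloc := Measurable.ite
    (measurableSet_le (s.measurable_price.comp measurable_snd) measurable_fst)
    measurable_const measurable_const
  measurable_buyerPay := Measurable.ite
    (measurableSet_le (s.measurable_price.comp measurable_snd) measurable_fst)
    (s.measurable_price.comp measurable_snd) measurable_const
  measurable_sellerPay := Measurable.ite
    (measurableSet_le (s.measurable_price.comp measurable_snd) measurable_fst)
    (s.measurable_price.comp measurable_snd) measurable_const
  alloc_mem v c := by split_ifs <;> simp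
  buyerPay_nonneg v c := by
    split_ifs
    · exact s.price_nonneg c
    · exact le_rfl
  sellerPay_nonneg v c := by
    split_ifs
    · exact s.price_nonneg c
    · exact le_rfl

/-- The buyer-offer mechanism: trade at the price offered by the buyer if the seller's value is
at most that price. -/
def BuyerOffer.mechanism {F G : Measure ℝ} (b : BuyerOffer F G) : Mechanism where
  alloc v c := if c ≤ b.price v then 1 else 0
  buyerPay v c := if c ≤ b.price v then b.price v else 0
  sellerPay v c := if c ≤ b.price v then b.price v else 0
  measurable_alloc := Measurable.ite
    (measurableSet_le measurable_snd (b.measurable_price.comp measurable_fst))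
    measurable_const measurable_const
  measurable_buyerPay := Measurable.ite
    (measurableSet_le measurable_snd (b.measurable_price.comp measurable_fst))
    (b.measurable_price.comp measurable_fst) measurable_const
  measurable_sellerPay := Measurable.ite
    (measurableSet_le measurable_snd (b.measurable_price.comp measurable_fst))
    (b.measurable_price.comp measurable_fst) measurable_const
  alloc_mem v c := by split_ifs <;> simp
  buyerPay_nonneg v c := by
    split_ifs
    · exact b.price_nonneg v
    · exact le_rfl
  sellerPay_nonneg v c := by
    split_ifs
    · exact b.price_nonneg v
    · exact le_rfl

/-- Run `M` with probability `t` and `N` with probability `1 - t`; allocation and payments are the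
expected ones. -/
def Mechanism.mix (t : unitInterval) (M N : Mechanism) : Mechanism where
  alloc v c := t * M.alloc v c + (1 - t) * N.alloc v c
  buyerPay v c := t * M.buyerPay v c + (1 - t) * N.buyerPay v c
  sellerPay v c := t * M.sellerPay v c + (1 - t) * N.sellerPay v c
  measurable_alloc :=
    (M.measurable_alloc.const_mul _).add (N.measurable_alloc.const_mul _)
  measurable_buyerPay :=
    (M.measurable_buyerPay.const_mul _).add (N.measurable_buyerPay.const_mul _)
  measurable_sellerPay :=
    (M.measurable_sellerPay.const_mul _).add (N.measurable_sellerPay.const_mul _)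
  alloc_mem v c := convex_Icc (0 : ℝ) 1 (M.alloc_mem v c) (N.alloc_mem v c)
    t.2.1 (sub_nonneg.2 t.2.2) (add_sub_cancel _ _)
  buyerPay_nonneg v c := add_nonneg (mul_nonneg t.2.1 (M.buyerPay_nonneg v c))
    (mul_nonneg (sub_nonneg.2 t.2.2) (N.buyerPay_nonneg v c))
  sellerPay_nonneg v c := add_nonneg (mul_nonneg t.2.1 (M.sellerPay_nonneg v c))
    (mul_nonneg (sub_nonneg.2 t.2.2) (N.sellerPay_nonneg v c))

/-- The biased random offer mechanism: the seller-offer mechanism with probability `t` and the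
buyer-offer mechanism with probability `1 - t`. -/
def biasedRandomOffer {F G : Measure ℝ} (t : unitInterval) (s : SellerOffer F G)
    (b : BuyerOffer F G) : Mechanism :=
  Mechanism.mix t s.mechanism b.mechanism

end BilateralTrade

end

/-! The seller-offer mechanism attains `Π*` and the buyer-offer mechanism attains `U*`. In fact more
is true: for every truthful `M`, even the buyer's payments minus the seller's cost are at most `Π*`.
Splitting `GFT(M) = E[v x - p] + E[p - c x]` at the buyer's payment gives `OPT_SB ≤ U* + Π*`
(`secondBest_le`). Along the mixtures both utilities are affine in the weight `t`, so a continuity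
argument yields a weight where both traders receive the same fraction `r` of their ideals. The
seller's share is at least `t` and the buyer's at least `1 - t`, so `r ≥ 1/2`
(`exists_fair_weight`). Offer mechanisms waste no money, hence the gains from trade of the mixture
are `r (Π* + U*)`.

The main work is the revenue bound `integral_payment_sub_cost_le`. For arbitrary priors it is proved
in allocation space, without densities or virtual values. Let `X a` be the interim allocation of
type `a`, `t u` the infimum value among types with `X ≥ u`, and `Q` the quantile function of the
cost. Incentive compatibility and individual rationality give `P a ≤ ∫₀^{X a} t`, while allocating
with total probability `X a` costs at least `∫₀^{X a} Q`. Averaging over `a` and exchanging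
integrals leaves `∫₀¹ (t u - Q u) μ{X ≥ u} du`, whose integrand is at most the profit of posting `t
u` at cost `Q u`. Since `Q` carries Lebesgue measure to the law of the cost, optimal posted prices
do at least as well. Reflecting the value axis gives the buyer's version.

Optimal prices exist by upper semicontinuity, and a suitable tie-break makes them monotone, hence
measurable. Finally, `Π*` and `U*` vanish together, since either one being zero rules out gains from
trade. -/

namespace BilateralTrade

/-! ### Quantiles and the cheapest allocation -/

/-- The quantile function of a distribution on `[0, B]`, truncated at `B`. -/
noncomputable def quantile (m : Measure ℝ) (B u : ℝ) : ℝ :=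
  sInf (insert B {c | 0 ≤ c ∧ u ≤ ProbabilityTheory.cdf m c})

section Quantile

variable {m : Measure ℝ} {B : ℝ}

theorem bddBelow_insert_of_nonneg (hB : 0 ≤ B) {A : Set ℝ} (hA : ∀ a ∈ A, 0 ≤ a) :
    BddBelow (insert B A) := by
  refine ⟨0, ?_⟩
  rintro x (rfl | hx)
  exacts [hB, hA x hx]

theorem sInf_insert_mem_Icc (hB : 0 ≤ B) {A : Set ℝ} (hA : ∀ a ∈ A, 0 ≤ a) :
    sInf (insert B A) ∈ Icc 0 B := by
  refine ⟨le_csInf (insert_nonempty _ _) ?_,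
    csInf_le (bddBelow_insert_of_nonneg hB hA) (mem_insert _ _)⟩
  rintro x (rfl | hx)
  exacts [hB, hA x hx]

theorem quantile_mem (hB : 0 ≤ B) (u : ℝ) : quantile m B u ∈ Icc 0 B :=
  sInf_insert_mem_Icc hB fun _ h => h.1

theorem monotone_quantile (hB : 0 ≤ B) : Monotone (quantile m B) := fun _ _ huw =>
  csInf_le_csInf (bddBelow_insert_of_nonneg hB fun _ h => h.1) (insert_nonempty _ _)
    (insert_subset_insert fun _ h => ⟨h.1, huw.trans h.2⟩)

theorem cdf_eq_one_of_le [IsProbabilityMeasure m] (hm : ∀ᵐ x ∂m, x ∈ Icc 0 B) {c : ℝ}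
    (hc : B ≤ c) : ProbabilityTheory.cdf m c = 1 := by
  rw [ProbabilityTheory.cdf_eq_real]
  have h : (Iic c : Set ℝ) =ᵐ[m] univ := by
    rw [Filter.eventuallyEq_univ]
    filter_upwards [hm] with x hx using hx.2.trans hc
  rw [measureReal_congr h, probReal_univ]

theorem quantile_le_iff [IsProbabilityMeasure m] (hB : 0 ≤ B) (hm : ∀ᵐ x ∂m, x ∈ Icc 0 B)
    {u c : ℝ} (hu : u ≤ 1) (hc : 0 ≤ c) :
    quantile m B u ≤ c ↔ u ≤ ProbabilityTheory.cdf m c := by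
  constructor
  · intro h
    -- The infimum need not be attained at `c` a priori; points just above `c` satisfy the
    -- inequality, and right continuity of the cdf passes it to `c`.
    have hright : Filter.Tendsto (ProbabilityTheory.cdf m) (nhdsWithin c (Ioi c))
        (nhds (ProbabilityTheory.cdf m c)) :=
      ((ProbabilityTheory.cdf m).right_continuous c).mono Ioi_subset_Ici_self
    refine ge_of_tendsto hright ?_
    filter_upwards [self_mem_nhdsWithin] with d hd
    obtain ⟨y, hy, hyd⟩ := exists_lt_of_csInf_lt (insert_nonempty _ _) (lt_of_le_of_lt h hd)
    have hyu : u ≤ ProbabilityTheory.cdf m y := by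
      rcases hy with rfl | hy
      · rwa [cdf_eq_one_of_le hm le_rfl]
      · exact hy.2
    exact hyu.trans (ProbabilityTheory.monotone_cdf m hyd.le)
  · exact fun h => csInf_le (bddBelow_insert_of_nonneg hB fun _ h => h.1) (Or.inr ⟨hc, h⟩)

/-- By the Galois connection `quantile_le_iff`, the part of `(0, 1]` sent into `(-∞, c]` is `(0, cdf
c]` for `c ≥ 0`, of length `cdf c`. -/
theorem map_quantile [IsProbabilityMeasure m] (hB : 0 ≤ B) (hm : ∀ᵐ x ∂m, x ∈ Icc 0 B) :
    (volume.restrict (Ioc (0 : ℝ) 1)).map (quantile m B) = m := by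
  have hmeas : Measurable (quantile m B) := (monotone_quantile hB).measurable
  have : IsProbabilityMeasure (volume.restrict (Ioc (0 : ℝ) 1)) := ⟨by simp⟩
  have : IsProbabilityMeasure ((volume.restrict (Ioc (0 : ℝ) 1)).map (quantile m B)) :=
    Measure.isProbabilityMeasure_map hmeas.aemeasurable
  refine Measure.ext_of_Iic _ _ fun c => ?_
  rw [Measure.map_apply hmeas measurableSet_Iic,
    Measure.restrict_apply (hmeas measurableSet_Iic)]
  rcases lt_or_ge c 0 with hc | hc
  · have h1 : quantile m B ⁻¹' Iic c ∩ Ioc 0 1 = ∅ := by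
      ext u
      simp only [mem_inter_iff, mem_preimage, mem_Iic, mem_empty_iff_false, iff_false]
      exact fun h => absurd ((quantile_mem hB u).1.trans h.1) (not_le.2 hc)
    have h2 : m (Iic c) = 0 := by
      rw [← nonpos_iff_eq_zero, ← ae_iff.1 hm]
      exact measure_mono fun x hx h => absurd (h.1.trans hx) (not_le.2 hc)
    rw [h1, h2, measure_empty]
  · have h1 : quantile m B ⁻¹' Iic c ∩ Ioc 0 1 = Ioc 0 (ProbabilityTheory.cdf m c) := by
      ext u
      simp only [mem_inter_iff, mem_preimage, mem_Iic, mem_Ioc]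
      constructor
      · exact fun h => ⟨h.2.1, (quantile_le_iff hB hm h.2.2 hc).1 h.1⟩
      · intro h
        have hu := h.2.trans (ProbabilityTheory.cdf_le_one m c)
        exact ⟨(quantile_le_iff hB hm hu hc).2 h.2, h.1, hu⟩
    rw [h1, Real.volume_Ioc, sub_zero, ProbabilityTheory.ofReal_cdf]

theorem integral_comp_quantile [IsProbabilityMeasure m] (hB : 0 ≤ B)
    (hm : ∀ᵐ x ∂m, x ∈ Icc 0 B) {g : ℝ → ℝ} (hg : Measurable g) :
    ∫ u in Ioc (0 : ℝ) 1, g (quantile m B u) = ∫ y, g y ∂m := by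
  conv_rhs => rw [← map_quantile hB hm]
  exact (integral_map (monotone_quantile hB).measurable.aemeasurable
    hg.aestronglyMeasurable).symm

theorem intervalIntegrable_of_monotone {f : ℝ → ℝ} (hf : Monotone f) (a b : ℝ) :
    IntervalIntegrable f volume a b := (hf.monotoneOn _).intervalIntegrable

end Quantile

theorem integrable_of_mem_Icc {α : Type*} [MeasurableSpace α] {μ : Measure α}
    [IsFiniteMeasure μ] {f : α → ℝ} {a b : ℝ} (hf : Measurable f) (h : ∀ᵐ x ∂μ, f x ∈ Icc a b) :
    Integrable f μ := by
  refine Integrable.of_bound (C := max |a| |b|) hf.aestronglyMeasurable ?_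
  filter_upwards [h] with x hx
  exact abs_le_max_abs_abs hx.1 hx.2

/-- Among all ways to allocate with total probability `q`, serving the lowest costs is cheapest. -/
theorem integral_quantile_le {Ω : Type*} [MeasurableSpace Ω] {ν : Measure Ω}
    [IsProbabilityMeasure ν] {C f : Ω → ℝ} {B : ℝ} (hB : 0 ≤ B) (hC : Measurable C)
    (hCB : ∀ᵐ b ∂ν, C b ∈ Icc 0 B) (hf : Measurable f) (hf01 : ∀ b, f b ∈ Icc (0 : ℝ) 1) :
    ∫ u in (0)..(∫ b, f b ∂ν), quantile (ν.map C) B u ≤ ∫ b, C b * f b ∂ν := by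
  have hprob : IsProbabilityMeasure (ν.map C) := Measure.isProbabilityMeasure_map hC.aemeasurable
  have hm : ∀ᵐ x ∂(ν.map C), x ∈ Icc 0 B :=
    (ae_map_iff hC.aemeasurable measurableSet_Icc).2 hCB
  set q := ∫ b, f b ∂ν with hq
  set Q := quantile (ν.map C) B with hQ
  have hQmono : Monotone Q := monotone_quantile hB
  have hfi : Integrable f ν := integrable_of_mem_Icc hf (ae_of_all _ hf01)
  have hq0 : 0 ≤ q := integral_nonneg fun b => (hf01 b).1
  have hq1 : q ≤ 1 := integral_le_of_ae_le zero_le_one (ae_of_all _ fun b => (hf01 b).2)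
  have hCf : Integrable (fun b => C b * f b) ν := by
    refine integrable_of_mem_Icc (a := 0) (b := B) (hC.mul hf) ?_
    filter_upwards [hCB] with b hb
    exact ⟨mul_nonneg hb.1 (hf01 b).1,
      (mul_le_of_le_one_right hb.1 (hf01 b).2).trans hb.2⟩
  have hCi : Integrable C ν := integrable_of_mem_Icc hC hCB
  have hmin : Integrable (fun b => min (C b - Q q) 0) ν :=
    (hCi.sub (integrable_const _)).inf (integrable_const 0)
  -- Lagrangian relaxation with multiplier `Q q`: as `f` takes values in `[0, 1]`, `(C - Q q) f ≥
  -- min (C - Q q) 0` pointwise. In quantile coordinates the right side is `Q u - Q q` on `[0, q]`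
  -- and zero beyond, so the relaxation is tight for the lowest costs.
  have h1 : ∫ b, min (C b - Q q) 0 ∂ν ≤ ∫ b, (C b * f b - Q q * f b) ∂ν := by
    refine integral_mono hmin (hCf.sub (hfi.const_mul _)) fun b => ?_
    have := hf01 b
    rcases le_total (C b - Q q) 0 with h | h
    · simp only [min_eq_left h]
      nlinarith [this.2]
    · simp only [min_eq_right h]
      nlinarith [this.1]
  rw [integral_sub hCf (hfi.const_mul _), integral_const_mul, ← hq] at h1
  have h2 : ∫ b, min (C b - Q q) 0 ∂ν = ∫ u in (0 : ℝ)..1, min (Q u - Q q) 0 := by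
    have hg : Measurable fun y : ℝ => min (y - Q q) 0 := by fun_prop
    rw [intervalIntegral.integral_of_le zero_le_one, hQ, integral_comp_quantile hB hm hg,
      integral_map hC.aemeasurable hg.aestronglyMeasurable]
  have hint : ∀ a b, IntervalIntegrable (fun u => min (Q u - Q q) 0) volume a b := fun a b =>
    intervalIntegrable_of_monotone (fun u w h => min_le_min_right _
      (sub_le_sub_right (hQmono h) _)) a b
  rw [← intervalIntegral.integral_add_adjacent_intervals (hint 0 q) (hint q 1)] at h2
  have h3 : ∫ u in (0)..q, min (Q u - Q q) 0 = ∫ u in (0)..q, (Q u - Q q) := by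
    refine intervalIntegral.integral_congr fun u hu => ?_
    rw [uIcc_of_le hq0] at hu
    exact min_eq_left (sub_nonpos.2 (hQmono hu.2))
  have h4 : ∫ u in q..1, min (Q u - Q q) 0 = 0 := by
    rw [intervalIntegral.integral_congr (g := fun _ => 0), intervalIntegral.integral_zero]
    intro u hu
    rw [uIcc_of_le hq1] at hu
    exact min_eq_right (sub_nonneg.2 (hQmono hu.1))
  rw [h3, h4, intervalIntegral.integral_sub (intervalIntegrable_of_monotone hQmono _ _)
    (by simp), intervalIntegral.integral_const] at h2
  simp only [sub_zero, add_zero, smul_eq_mul] at h2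
  linarith

/-! ### Tariffs and threshold prices -/

/-- A function whose increments are dominated by right endpoint sums of a monotone function is
dominated by its integral. -/
theorem sub_le_intervalIntegral_of_monotone {T t : ℝ → ℝ} {q : ℝ} (hq : 0 ≤ q) (ht : Monotone t)
    (hT : ∀ a b, 0 ≤ a → a ≤ b → b ≤ q → T b - T a ≤ t b * (b - a)) :
    T q - T 0 ≤ ∫ u in (0)..q, t u := by
  have hint := intervalIntegrable_of_monotone ht
  -- On an equal partition the errors `(t b - t a) * (b - a)` telescope to `(t q - t 0)` times the
  -- mesh, which tends to zero.
  have hstep : ∀ a b, 0 ≤ a → a ≤ b → b ≤ q →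
      T b - T a ≤ (∫ u in a..b, t u) + (t b - t a) * (b - a) := by
    intro a b ha hab hb
    have h1 : ∫ _ in a..b, t a ≤ ∫ u in a..b, t u :=
      intervalIntegral.integral_mono_on hab (by simp) (hint a b) fun u hu => ht hu.1
    rw [intervalIntegral.integral_const, smul_eq_mul] at h1
    linarith [hT a b ha hab hb]
  have hn : ∀ n : ℕ, T q - T 0 ≤ (∫ u in (0)..q, t u) + (t q - t 0) * (q / (n + 1)) := by
    intro n
    have hd : 0 ≤ q / (n + 1 : ℝ) := by positivity
    have key : ∀ k : ℕ, k ≤ n + 1 → T (k * (q / (n + 1))) - T 0 ≤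
        (∫ u in (0)..(k * (q / (n + 1))), t u) +
          (t (k * (q / (n + 1))) - t 0) * (q / (n + 1)) := by
      intro k
      induction k with
      | zero => simp
      | succ k ih =>
        intro hk
        have hk' : ((k : ℝ) + 1) ≤ n + 1 := by exact_mod_cast hk
        have hle : ((k + 1 : ℕ) : ℝ) * (q / (n + 1)) ≤ q := by
          push_cast
          calc ((k : ℝ) + 1) * (q / (n + 1)) ≤ (n + 1) * (q / (n + 1)) := by gcongr
            _ = q := by field_simp
        have h1 := hstep (k * (q / (n + 1))) ((k + 1 : ℕ) * (q / (n + 1))) (by positivity)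
          (by push_cast; linarith) hle
        rw [← intervalIntegral.integral_add_adjacent_intervals
          (hint 0 (k * (q / (n + 1)))) (hint _ _)]
        have h2 := ih (by omega)
        have h3 : ((k + 1 : ℕ) : ℝ) * (q / (n + 1)) - k * (q / (n + 1)) = q / (n + 1) := by
          push_cast
          ring
        rw [h3] at h1
        linarith
    have h := key (n + 1) le_rfl
    have h1 : ((n + 1 : ℕ) : ℝ) * (q / (n + 1)) = q := by
      push_cast
      field_simp
    rwa [h1] at h
  have hlim : Filter.Tendsto (fun n : ℕ => (∫ u in (0)..q, t u) + (t q - t 0) * (q / (n + 1)))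
      Filter.atTop (nhds ((∫ u in (0)..q, t u) + (t q - t 0) * 0)) := by
    refine (Filter.Tendsto.const_mul _ ?_).const_add _
    simpa [div_eq_mul_inv] using (tendsto_one_div_add_atTop_nhds_zero_nat (𝕜 := ℝ)).const_mul q
  simpa using ge_of_tendsto' hlim hn

/-- The posted price at which the interim allocation `X` reaches the level `u`. -/
noncomputable def threshold {Ω : Type*} (S : Set Ω) (V X : Ω → ℝ) (B u : ℝ) : ℝ :=
  sInf (insert B (V '' {s | s ∈ S ∧ u ≤ X s}))

section Threshold

variable {Ω : Type*} {S : Set Ω} {V X P : Ω → ℝ} {B : ℝ}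

theorem threshold_mem (hB : 0 ≤ B) (hV : ∀ a ∈ S, V a ∈ Icc 0 B) (u : ℝ) :
    threshold S V X B u ∈ Icc 0 B := by
  refine sInf_insert_mem_Icc hB ?_
  rintro _ ⟨s, hs, rfl⟩
  exact (hV s hs.1).1

theorem bddBelow_threshold (hB : 0 ≤ B) (hV : ∀ a ∈ S, V a ∈ Icc 0 B) (u : ℝ) :
    BddBelow (insert B (V '' {s | s ∈ S ∧ u ≤ X s})) := by
  refine bddBelow_insert_of_nonneg hB ?_
  rintro _ ⟨s, hs, rfl⟩
  exact (hV s hs.1).1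

theorem monotone_threshold (hB : 0 ≤ B) (hV : ∀ a ∈ S, V a ∈ Icc 0 B) :
    Monotone (threshold S V X B) := fun u _ huw =>
  csInf_le_csInf (bddBelow_threshold hB hV u) (insert_nonempty _ _)
    (insert_subset_insert (image_mono fun _ h => ⟨h.1, huw.trans h.2⟩))

theorem threshold_le (hB : 0 ≤ B) (hV : ∀ a ∈ S, V a ∈ Icc 0 B) {u : ℝ} {a : Ω} (ha : a ∈ S)
    (hu : u ≤ X a) : threshold S V X B u ≤ V a :=
  csInf_le (bddBelow_threshold hB hV u) (Or.inr ⟨a, ⟨ha, hu⟩, rfl⟩)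

/-- Incentive compatibility bounds the payment by the integral of the threshold prices. -/
theorem payment_le_integral_threshold (hB : 0 ≤ B) (hV : ∀ a ∈ S, V a ∈ Icc 0 B)
    (hX : ∀ a, X a ∈ Icc (0 : ℝ) 1)
    (hIC : ∀ a ∈ S, ∀ b ∈ S, V a * X b - P b ≤ V a * X a - P a)
    (hIR : ∀ a ∈ S, 0 ≤ V a * X a - P a) {a : Ω} (ha : a ∈ S) :
    P a ≤ ∫ u in (0)..(X a), threshold S V X B u := by
  -- `T` is the conjugate of the indirect utility, a tariff on allocation levels. The line of type
  -- `a` gives `P a ≤ T (X a)`, and individual rationality gives `T 0 ≤ 0`; so it suffices to bound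
  -- the increments of `T` by threshold prices.
  set T : ℝ → ℝ := fun q => sSup ((fun s => V s * q - (V s * X s - P s)) '' S) with hTdef
  have hne : ∀ q : ℝ, ((fun s => V s * q - (V s * X s - P s)) '' S).Nonempty :=
    fun q => ⟨_, a, ha, rfl⟩
  have hbdd : ∀ q : ℝ, 0 ≤ q → BddAbove ((fun s => V s * q - (V s * X s - P s)) '' S) := by
    refine fun q hq => ⟨B * q, ?_⟩
    rintro _ ⟨s, hs, rfl⟩
    have := mul_le_mul_of_nonneg_right (hV s hs).2 hq
    simp only
    linarith [hIR s hs]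
  have hTle : ∀ q, 0 ≤ q → ∀ s ∈ S, V s * q - (V s * X s - P s) ≤ T q := fun q hq s hs =>
    le_csSup (hbdd q hq) ⟨s, hs, rfl⟩
  have h0 : T 0 ≤ 0 := by
    refine csSup_le (hne 0) ?_
    rintro _ ⟨s, hs, rfl⟩
    simp only
    linarith [hIR s hs]
  have ha' : P a ≤ T (X a) := by
    have := hTle (X a) (hX a).1 a ha
    linarith
  refine le_trans (by linarith) (sub_le_intervalIntegral_of_monotone (T := T) (hX a).1
    (monotone_threshold hB hV) fun q r hq hqr hr => ?_)
  have hqr' : 0 ≤ r - q := sub_nonneg.2 hqr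
  have hqr1 : r - q ≤ 1 := by linarith [(hX a).2]
  rw [sub_le_iff_le_add]
  refine csSup_le (hne r) ?_
  rintro _ ⟨s, hs, rfl⟩
  refine le_of_forall_pos_le_add fun ε hε => ?_
  -- A line of slope at most `threshold + ε` lies below `T q` at `q` and climbs little enough up to
  -- `r`; the slack `ε` allows for an infimum that is not attained.
  have hbound : ∀ w ∈ S, V w ≤ threshold S V X B r + ε →
      V w * r - (V w * X w - P w) ≤ threshold S V X B r * (r - q) + T q + ε := by
    intro w hw hwt
    have h1 := mul_le_mul_of_nonneg_right hwt hqr'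
    have h2 := mul_le_mul_of_nonneg_left hqr1 hε.le
    linarith [hTle q hq w hw]
  -- A steeper type `s` is replaced by a flatter type `w` with `X w ≥ r`: since `s` does not gain by
  -- imitating `w`, and `V w < V s`, the line of `w` is the higher one at `r`.
  rcases le_or_gt (V s) (threshold S V X B r + ε) with h | h
  · exact hbound s hs h
  · obtain ⟨y, hy, hyt⟩ := exists_lt_of_csInf_lt (insert_nonempty _ _)
      (show sInf (insert B (V '' {s | s ∈ S ∧ r ≤ X s})) < threshold S V X B r + ε from
        lt_add_of_pos_right _ hε)
    rcases hy with rfl | ⟨w, ⟨hw, hwr⟩, rfl⟩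
    · exact absurd (hV s hs).2 (not_le.2 (hyt.trans h))
    · have h1 := hbound w hw hyt.le
      have h2 := mul_le_mul_of_nonneg_left hwr (sub_nonneg.2 (hyt.trans h).le)
      simp only
      linarith [hIC s hs w hw]

end Threshold

/-! ### The revenue bound -/

/-- No incentive compatible mechanism extracts more from a trader of type `V`, net of the cost `C`,
than posting an optimal price for every cost. -/
theorem integral_payment_sub_cost_le {Ω₁ Ω₂ : Type*} [MeasurableSpace Ω₁] [MeasurableSpace Ω₂]
    {μ : Measure Ω₁} {ν : Measure Ω₂} [IsProbabilityMeasure μ] [IsProbabilityMeasure ν]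
    {S : Set Ω₁} {V P : Ω₁ → ℝ} {C : Ω₂ → ℝ} {x : Ω₁ → Ω₂ → ℝ} {R : ℝ → ℝ} {K : Set ℝ} {B : ℝ}
    (hB : 0 ≤ B) (hS : ∀ᵐ a ∂μ, a ∈ S) (hV : ∀ a ∈ S, V a ∈ Icc 0 B)
    (hC : Measurable C) (hCB : ∀ᵐ b ∂ν, C b ∈ Icc 0 B)
    (hx : Measurable (Function.uncurry x)) (hx01 : ∀ a b, x a b ∈ Icc (0 : ℝ) 1)
    (hP : Integrable P μ)
    (hIC : ∀ a ∈ S, ∀ r ∈ S,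
      V a * (∫ b, x r b ∂ν) - P r ≤ V a * (∫ b, x a b ∂ν) - P a)
    (hIR : ∀ a ∈ S, 0 ≤ V a * (∫ b, x a b ∂ν) - P a)
    (hK : MeasurableSet K) (hCK : ∀ᵐ b ∂ν, C b ∈ K)
    (hR : Measurable R) (hRi : Integrable (fun b => R (C b)) ν)
    (hRopt : ∀ c ∈ K, ∀ p ∈ Icc 0 B, (p - c) * μ.real {a | p ≤ V a} ≤ R c) :
    ∫ a, P a ∂μ - ∫ a, ∫ b, C b * x a b ∂ν ∂μ ≤ ∫ b, R (C b) ∂ν := by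
  have hprob : IsProbabilityMeasure (ν.map C) := Measure.isProbabilityMeasure_map hC.aemeasurable
  have hm : ∀ᵐ y ∂(ν.map C), y ∈ Icc 0 B :=
    (ae_map_iff hC.aemeasurable measurableSet_Icc).2 hCB
  have hmK : ∀ᵐ y ∂(ν.map C), y ∈ K := (ae_map_iff hC.aemeasurable hK).2 hCK
  have hI : IsProbabilityMeasure (volume.restrict (Ioc (0 : ℝ) 1)) := ⟨by simp⟩
  set X : Ω₁ → ℝ := fun a => ∫ b, x a b ∂ν with hXdef
  set t := threshold S V X B with htdef
  set Q := quantile (ν.map C) B with hQdef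
  have hQmono : Monotone Q := monotone_quantile hB
  have htmono : Monotone t := monotone_threshold hB hV
  have hQB : ∀ u, Q u ∈ Icc 0 B := quantile_mem hB
  have htB : ∀ u, t u ∈ Icc 0 B := threshold_mem hB hV
  have hXmeas : Measurable X := hx.stronglyMeasurable.integral_prod_right.measurable
  have hX01 : ∀ a, X a ∈ Icc (0 : ℝ) 1 := fun a =>
    ⟨integral_nonneg fun b => (hx01 a b).1,
      integral_le_of_ae_le zero_le_one (ae_of_all _ fun b => (hx01 a b).2)⟩
  have hCx : Integrable (fun z : Ω₁ × Ω₂ => C z.2 * x z.1 z.2) (μ.prod ν) := by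
    refine integrable_of_mem_Icc (a := 0) (b := B) ((hC.comp measurable_snd).mul hx) ?_
    filter_upwards [Measure.quasiMeasurePreserving_snd.ae hCB] with z hz
    exact ⟨mul_nonneg hz.1 (hx01 _ _).1, (mul_le_of_le_one_right hz.1 (hx01 _ _).2).trans hz.2⟩
  -- Integrated over `u`, `g` bounds the net payment of type `a`; integrated over `a`, it is `t u -
  -- Q u` times the mass of types served at level `u`. The proof is the exchange of these two
  -- integrals.
  set g : Ω₁ → ℝ → ℝ := fun a u => if u ≤ X a then t u - Q u else 0 with hgdef
  have hgmeas : Measurable (Function.uncurry g) :=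
    Measurable.ite (measurableSet_le measurable_snd (hXmeas.comp measurable_fst))
      ((htmono.measurable.sub hQmono.measurable).comp measurable_snd) measurable_const
  have hgB : ∀ a u, g a u ∈ Icc (-B) B := by
    intro a u
    simp only [hgdef]
    split_ifs
    · constructor <;> linarith [(htB u).1, (htB u).2, (hQB u).1, (hQB u).2]
    · exact ⟨by linarith, hB⟩
  have hgint : Integrable (Function.uncurry g) (μ.prod (volume.restrict (Ioc (0 : ℝ) 1))) :=
    integrable_of_mem_Icc hgmeas (ae_of_all _ fun z => hgB z.1 z.2)
  have hpoint : ∀ᵐ a ∂μ, P a - ∫ b, C b * x a b ∂ν ≤ ∫ u in Ioc (0 : ℝ) 1, g a u := by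
    filter_upwards [hS] with a ha
    have h1 := payment_le_integral_threshold hB hV hX01 hIC hIR ha
    have h2 := integral_quantile_le hB hC hCB (hx.comp measurable_prodMk_left) (hx01 a)
    have h3 : ∫ u in Ioc (0 : ℝ) 1, g a u = ∫ u in (0)..(X a), (t u - Q u) := by
      rw [intervalIntegral.integral_of_le (hX01 a).1]
      have h4 : Ioc 0 (X a) = Ioc (0 : ℝ) 1 ∩ Iic (X a) := by
        rw [Ioc_inter_Iic, min_eq_right (hX01 a).2]
      rw [h4, ← setIntegral_indicator measurableSet_Iic]
      rfl
    rw [h3, intervalIntegral.integral_sub (intervalIntegrable_of_monotone htmono _ _)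
      (intervalIntegrable_of_monotone hQmono _ _)]
    exact sub_le_sub h1 h2
  have hswap : ∫ a, (∫ u in Ioc (0 : ℝ) 1, g a u) ∂μ = ∫ u in Ioc (0 : ℝ) 1, ∫ a, g a u ∂μ :=
    integral_integral_swap hgint
  have hinner : ∀ᵐ u ∂(volume.restrict (Ioc (0 : ℝ) 1)), ∫ a, g a u ∂μ ≤ R (Q u) := by
    have hQK : ∀ᵐ u ∂(volume.restrict (Ioc (0 : ℝ) 1)), Q u ∈ K := by
      refine ae_of_ae_map hQmono.measurable.aemeasurable (p := fun y => y ∈ K) ?_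
      rwa [map_quantile hB hm]
    filter_upwards [hQK] with u hu
    have h1 : ∫ a, g a u ∂μ = (t u - Q u) * μ.real {a | u ≤ X a} := by
      have h2 : (fun a => g a u) = indicator {a | u ≤ X a} fun _ => t u - Q u := rfl
      rw [h2, integral_indicator (measurableSet_le measurable_const hXmeas), setIntegral_const,
        smul_eq_mul, mul_comm]
    rw [h1]
    -- A level priced below cost loses money, whereas `R ≥ 0` because posting the cost itself earns
    -- zero. Otherwise every type in `S` with `X ≥ u` would also buy at the posted price `t u`.
    rcases le_total (t u) (Q u) with h | h
    · have h3 := hRopt (Q u) hu (Q u) (hQB u)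
      rw [sub_self, zero_mul] at h3
      exact (mul_nonpos_of_nonpos_of_nonneg (sub_nonpos.2 h) measureReal_nonneg).trans h3
    · refine le_trans (mul_le_mul_of_nonneg_left ?_ (sub_nonneg.2 h)) (hRopt _ hu _ (htB u))
      refine ENNReal.toReal_mono (measure_ne_top _ _) (measure_mono_ae ?_)
      filter_upwards [hS] with a ha hua
      exact threshold_le hB hV ha hua
  have hRQ : Integrable (fun u => R (Q u)) (volume.restrict (Ioc (0 : ℝ) 1)) := by
    have h1 : Integrable R (ν.map C) :=
      (integrable_map_measure hR.aestronglyMeasurable hC.aemeasurable).2 hRi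
    rw [← map_quantile hB hm] at h1
    exact (integrable_map_measure hR.aestronglyMeasurable
      hQmono.measurable.aemeasurable).1 h1
  calc ∫ a, P a ∂μ - ∫ a, ∫ b, C b * x a b ∂ν ∂μ
      = ∫ a, (P a - ∫ b, C b * x a b ∂ν) ∂μ := (integral_sub hP hCx.integral_prod_left).symm
    _ ≤ ∫ a, (∫ u in Ioc (0 : ℝ) 1, g a u) ∂μ :=
        integral_mono_ae (hP.sub hCx.integral_prod_left) hgint.integral_prod_left hpoint
    _ = ∫ u in Ioc (0 : ℝ) 1, ∫ a, g a u ∂μ := hswap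
    _ ≤ ∫ u in Ioc (0 : ℝ) 1, R (Q u) := integral_mono_ae hgint.integral_prod_right hRQ hinner
    _ = ∫ y, R y ∂(ν.map C) := integral_comp_quantile hB hm hR
    _ = ∫ b, R (C b) ∂ν := integral_map hC.aemeasurable hR.aestronglyMeasurable

/-! ### Existence of optimal measurable prices -/

/-- The tail `p ↦ m (Iic (-p))` is decreasing and left continuous, hence upper semicontinuous.
Multiplying by `p - c` preserves this where the factor is nonnegative, which is why the interval
starts at `c`. -/
theorem upperSemicontinuousOn_profit (m : Measure ℝ) [IsProbabilityMeasure m] (c : ℝ) (B : ℝ) :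
    UpperSemicontinuousOn (fun p => (p - c) * m.real (Iic (-p))) (Icc c B) := by
  intro x hx y hy
  obtain ⟨h, hyh, hh⟩ : ∃ h, (x - c) * h < y ∧ m.real (Iic (-x)) < h := by
    have h1 : ∀ᶠ h in nhdsWithin (m.real (Iic (-x))) (Ioi (m.real (Iic (-x)))),
        (x - c) * h < y :=
      ((continuous_const.mul continuous_id).tendsto _ |>.eventually_lt_const hy).filter_mono
        nhdsWithin_le_nhds
    exact (h1.and self_mem_nhdsWithin).exists
  have hright : ∀ᶠ z in nhdsWithin (-x) (Ioi (-x)), ProbabilityTheory.cdf m z < h := by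
    have h2 : Filter.Tendsto (ProbabilityTheory.cdf m) (nhdsWithin (-x) (Ioi (-x)))
        (nhds (ProbabilityTheory.cdf m (-x))) :=
      ((ProbabilityTheory.cdf m).right_continuous (-x)).mono Ioi_subset_Ici_self
    rw [ProbabilityTheory.cdf_eq_real] at h2
    exact h2.eventually_lt_const hh
  obtain ⟨z, hz, hxz⟩ := (hright.and self_mem_nhdsWithin).exists
  have h3 : ∀ᶠ p in nhds x, (p - c) * h < y :=
    (((continuous_id.sub continuous_const).mul continuous_const).tendsto x).eventually_lt_const
      hyh
  have h4 : ∀ᶠ p in nhds x, -z < p := lt_mem_nhds (by linarith [show -x < z from hxz])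
  filter_upwards [nhdsWithin_le_nhds h3, nhdsWithin_le_nhds h4, self_mem_nhdsWithin] with p h3 h4 hp
  refine lt_of_le_of_lt (mul_le_mul_of_nonneg_left ?_ (sub_nonneg.2 hp.1)) h3
  rw [← ProbabilityTheory.cdf_eq_real]
  exact (ProbabilityTheory.monotone_cdf m (by linarith)).trans hz.le

/-- Writing the probability of sale as `m (Iic (-p))` serves both traders: `m` is the law of `-v`
for the seller, and `G` itself for the buyer, who acts as a seller of cost `-v`. The last clause is
a tie-break: the price is the cost unless a positive profit is possible, and then a sale has
positive probability. Without it optimal prices need not be monotone. -/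
theorem exists_optimal_price (m : Measure ℝ) [IsProbabilityMeasure m] {B : ℝ}
    (hB : ∀ p, B < p → m.real (Iic (-p)) = 0) (c : ℝ) :
    ∃ p, (∀ r, (r - c) * m.real (Iic (-r)) ≤ (p - c) * m.real (Iic (-p))) ∧
      (p = c ∨ c < p ∧ 0 < m.real (Iic (-p))) := by
  by_cases h : ∀ r, (r - c) * m.real (Iic (-r)) ≤ 0
  · exact ⟨c, by simpa using h, Or.inl rfl⟩
  push Not at h
  obtain ⟨r₀, hr₀⟩ := h
  have hr₀c : c < r₀ := by
    by_contra hle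
    exact absurd hr₀ (not_lt.2 (mul_nonpos_of_nonpos_of_nonneg
      (sub_nonpos.2 (not_lt.1 hle)) measureReal_nonneg))
  have hr₀B : r₀ ≤ B := by
    by_contra hle
    rw [hB _ (not_le.1 hle), mul_zero] at hr₀
    exact lt_irrefl _ hr₀
  obtain ⟨p, hp, hmax⟩ := UpperSemicontinuousOn.exists_isMaxOn
    (nonempty_Icc.2 (hr₀c.le.trans hr₀B)) isCompact_Icc (upperSemicontinuousOn_profit m c B)
  have hpos : 0 < (p - c) * m.real (Iic (-p)) := lt_of_lt_of_le hr₀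
    (isMaxOn_iff.1 hmax r₀ ⟨hr₀c.le, hr₀B⟩)
  have hHp : 0 < m.real (Iic (-p)) := by
    refine lt_of_le_of_ne measureReal_nonneg fun h0 => ?_
    rw [← h0, mul_zero] at hpos
    exact lt_irrefl _ hpos
  refine ⟨p, fun r => ?_, Or.inr ⟨sub_pos.1 ((pos_iff_pos_of_mul_pos hpos).2 hHp), hHp⟩⟩
  rcases lt_or_ge r c with hr | hr
  · exact (mul_nonpos_of_nonpos_of_nonneg (sub_nonpos.2 hr.le) measureReal_nonneg).trans hpos.le
  rcases lt_or_ge B r with hr' | hr'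
  · rw [hB r hr', mul_zero]
    exact hpos.le
  · exact isMaxOn_iff.1 hmax r ⟨hr, hr'⟩

/-- Optimal prices increase with the cost. -/
theorem monotone_of_optimal {H g : ℝ → ℝ} (hH : Antitone H)
    (hopt : ∀ c r, (r - c) * H r ≤ (g c - c) * H (g c))
    (hg : ∀ c, g c = c ∨ c < g c ∧ 0 < H (g c)) : Monotone g := by
  refine monotone_iff_forall_lt.2 fun c d hcd => ?_
  rcases hg d with hd | ⟨hd, hdH⟩
  · rcases hg c with hc | ⟨hc, hcH⟩
    · linarith
    · have h := hopt d (g c)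
      rw [hd, sub_self, zero_mul] at h
      rw [hd]
      by_contra hlt
      exact absurd h (not_le.2 (mul_pos (sub_pos.2 (not_le.1 hlt)) hcH))
  · rcases hg c with hc | ⟨hc, hcH⟩
    · linarith
    · by_contra hlt
      -- Adding the two optimality inequalities gives `(d - c) * (H (g d) - H (g c)) ≤ 0`, so the
      -- two sale probabilities agree. Being positive, their common value cancels from `h2`, which
      -- contradicts `g d < g c`.
      have h1 := hopt c (g d)
      have h2 := hopt d (g c)
      have h3 : H (g c) ≤ H (g d) := hH (not_le.1 hlt).le
      have h4 := mul_nonneg (sub_pos.2 hcd).le (sub_nonneg.2 h3)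
      have h5 : H (g c) = H (g d) := by
        refine le_antisymm h3 ?_
        by_contra h6
        have := mul_pos (sub_pos.2 hcd) (sub_pos.2 (not_le.1 h6))
        linarith
      rw [h5] at h2
      have := le_of_mul_le_mul_right h2 hdH
      linarith

/-- With the tie-break any pointwise choice is automatically monotone, so measurability needs no
selection theorem. -/
theorem exists_monotone_optimal_price (m : Measure ℝ) [IsProbabilityMeasure m] {B : ℝ}
    (hB : ∀ p, B < p → m.real (Iic (-p)) = 0) :
    ∃ g : ℝ → ℝ, Monotone g ∧
      (∀ c r, (r - c) * m.real (Iic (-r)) ≤ (g c - c) * m.real (Iic (-g c))) ∧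
      ∀ c, g c = c ∨ c < g c ∧ 0 < m.real (Iic (-g c)) := by
  choose g hopt hg using exists_optimal_price m hB
  refine ⟨g, monotone_of_optimal (H := fun p => m.real (Iic (-p))) (fun p r hpr => ?_) hopt hg,
    hopt, hg⟩
  exact measureReal_mono (Iic_subset_Iic.2 (neg_le_neg hpr))

theorem IsPrior.support_subset {μ : Measure ℝ} {b : ℝ} (hb : ∀ᵐ x ∂μ, x ∈ Icc 0 b) :
    μ.support ⊆ Icc 0 b := by
  intro x hx
  by_contra hxb
  exact (Measure.mem_support_iff_forall x).1 hx _ (isClosed_Icc.isOpen_compl.mem_nhds hxb)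
    |>.ne' (mem_ae_iff.1 hb)

theorem IsPrior.exists_Icc {μ : Measure ℝ} (h : IsPrior μ) :
    ∃ b : ℝ, 0 ≤ b ∧ ∀ᵐ x ∂μ, x ∈ Icc 0 b := h.exists_bound

theorem nonempty_sellerOffer {F G : Measure ℝ} (hF : IsPrior F) (hG : IsPrior G) :
    Nonempty (SellerOffer F G) := by
  have := hF.isProbabilityMeasure
  obtain ⟨b, hb, hFb⟩ := hF.exists_Icc
  obtain ⟨d, hd, hGd⟩ := hG.exists_Icc
  have : IsProbabilityMeasure (F.map Neg.neg) :=
    Measure.isProbabilityMeasure_map measurable_neg.aemeasurable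
  have hH : ∀ p, (F.map Neg.neg).real (Iic (-p)) = F.real (Ici p) := by
    intro p
    rw [map_measureReal_apply measurable_neg measurableSet_Iic]
    congr 1
    ext x
    simp
  obtain ⟨g, hmono, hopt, hg⟩ := exists_monotone_optimal_price (F.map Neg.neg) (B := b) (by
    intro p hp
    rw [hH, measureReal_def, ENNReal.toReal_eq_zero_iff]
    refine Or.inl (measure_mono_null (t := (Icc 0 b)ᶜ) (fun x hx h => ?_) (mem_ae_iff.1 hFb))
    exact absurd (le_trans hx h.2) (not_le.2 hp))
  -- The truncation changes nothing on the support of `G`, where `g c ≥ c ≥ 0`.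
  refine ⟨⟨fun c => max (g c) 0, (hmono.measurable.max measurable_const),
    fun c => le_max_right _ _, fun c hc p _ => ?_⟩⟩
  have hc0 : 0 ≤ c := (IsPrior.support_subset hGd hc).1
  have hgc : c ≤ g c := (hg c).elim (fun h => h.ge) fun h => h.1.le
  rw [max_eq_left (hc0.trans hgc), ← hH, ← hH]
  exact hopt c p

theorem nonempty_buyerOffer {F G : Measure ℝ} (hF : IsPrior F) (hG : IsPrior G) :
    Nonempty (BuyerOffer F G) := by
  have := hG.isProbabilityMeasure
  obtain ⟨b, hb, hFb⟩ := hF.exists_Icc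
  obtain ⟨d, hd, hGd⟩ := hG.exists_Icc
  have hG0 : ∀ p, 0 < p → G.real (Iic (-p)) = 0 := by
    intro p hp
    rw [measureReal_def, ENNReal.toReal_eq_zero_iff]
    refine Or.inl (measure_mono_null (t := (Icc 0 d)ᶜ) (fun x hx h => ?_) (mem_ae_iff.1 hGd))
    exact absurd (h.1.trans hx) (not_le.2 (neg_lt_zero.2 hp))
  obtain ⟨g, hmono, hopt, hg⟩ := exists_monotone_optimal_price G hG0
  -- The price is reflected back. Again the truncation is void on the support: a positive `g (-v)`
  -- would be an offer below zero, accepted with probability zero, which the tie-break excludes.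
  refine ⟨⟨fun v => max (-g (-v)) 0,
    ((hmono.measurable.comp measurable_neg).neg.max measurable_const),
    fun c => le_max_right _ _, fun v hv p _ => ?_⟩⟩
  have hv0 : 0 ≤ v := (IsPrior.support_subset hFb hv).1
  have hgv : g (-v) ≤ 0 := by
    by_contra hpos
    rcases hg (-v) with h | h
    · linarith
    · exact absurd (hG0 _ (not_le.1 hpos)) h.2.ne'
  rw [max_eq_left (neg_nonneg.2 hgv)]
  have h := hopt (-v) (-p)
  rw [neg_neg] at h
  linarith

/-! ### Interim utilities in the offer mechanisms -/

theorem buyerInterim_buyerOffer {F G : Measure ℝ} (o : BuyerOffer F G) (v r : ℝ) :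
    buyerInterim G o.mechanism v r = (v - o.price r) * G.real (Iic (o.price r)) := by
  have h : (fun c => v * o.mechanism.alloc r c - o.mechanism.buyerPay r c) =
      indicator (Iic (o.price r)) fun _ => v - o.price r := by
    funext c
    by_cases hc : c ≤ o.price r <;> simp [BuyerOffer.mechanism, hc]
  rw [buyerInterim, h, integral_indicator measurableSet_Iic, setIntegral_const, smul_eq_mul,
    mul_comm]

theorem sellerInterim_sellerOffer {F G : Measure ℝ} (o : SellerOffer F G) (c r : ℝ) :
    sellerInterim F o.mechanism c r = (o.price r - c) * F.real (Ici (o.price r)) := by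
  have h : (fun v => o.mechanism.sellerPay v r - c * o.mechanism.alloc v r) =
      indicator (Ici (o.price r)) fun _ => o.price r - c := by
    funext v
    by_cases hv : o.price r ≤ v <;> simp [SellerOffer.mechanism, hv]
  rw [sellerInterim, h, integral_indicator measurableSet_Ici, setIntegral_const, smul_eq_mul,
    mul_comm]

/-- An offer above `b` is accepted with probability one and loses money, whereas offering `v` loses
nothing. This bounds the payments; in the seller-offer mechanism they are bounded by the buyer's bid
anyway. -/
theorem BuyerOffer.price_le {F G : Measure ℝ} [IsProbabilityMeasure G] {b : ℝ}
    (hF : ∀ᵐ v ∂F, v ∈ Icc 0 b) (hG : ∀ᵐ c ∂G, c ∈ Icc 0 b) (o : BuyerOffer F G) {v : ℝ} (hv : v ∈ F.support) : o.price v ≤ b := by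
  have hvb := IsPrior.support_subset hF hv
  by_contra hlt
  have h := o.optimal v hv v hvb.1
  rw [← ProbabilityTheory.cdf_eq_real G (o.price v),
    cdf_eq_one_of_le hG (not_le.1 hlt).le] at h
  linarith [hvb.2]

/-! ### Utilities as integrals over the product measure -/

section Mechanism

variable {F G : Measure ℝ} [IsProbabilityMeasure F] [IsProbabilityMeasure G] {b : ℝ}
  {M N : Mechanism}

theorem integrable_alloc (F G : Measure ℝ) [IsProbabilityMeasure F] [IsProbabilityMeasure G]
    (M : Mechanism) : Integrable (fun z : ℝ × ℝ => M.alloc z.1 z.2) (F.prod G) :=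
  integrable_of_mem_Icc M.measurable_alloc (ae_of_all _ fun z => M.alloc_mem z.1 z.2)

theorem integrable_alloc_right (G : Measure ℝ) [IsProbabilityMeasure G] (M : Mechanism) (v : ℝ) :
    Integrable (fun c => M.alloc v c) G :=
  integrable_of_mem_Icc (M.measurable_alloc.comp measurable_prodMk_left)
    (ae_of_all _ fun c => M.alloc_mem v c)

theorem integrable_alloc_left (F : Measure ℝ) [IsProbabilityMeasure F] (M : Mechanism) (c : ℝ) :
    Integrable (fun v => M.alloc v c) F :=
  integrable_of_mem_Icc (M.measurable_alloc.comp measurable_prodMk_right)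
    (ae_of_all _ fun v => M.alloc_mem v c)

theorem mul_alloc_mem (M : Mechanism) {y v c : ℝ} (hy : y ∈ Icc 0 b) :
    y * M.alloc v c ∈ Icc 0 b :=
  ⟨mul_nonneg hy.1 (M.alloc_mem v c).1,
    (mul_le_of_le_one_right hy.1 (M.alloc_mem v c).2).trans hy.2⟩

theorem integrable_value_alloc (G : Measure ℝ) [IsProbabilityMeasure G]
    (hF : ∀ᵐ v ∂F, v ∈ Icc 0 b) (M : Mechanism) :
    Integrable (fun z : ℝ × ℝ => z.1 * M.alloc z.1 z.2) (F.prod G) := by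
  refine integrable_of_mem_Icc (a := 0) (b := b) (measurable_fst.mul M.measurable_alloc) ?_
  filter_upwards [Measure.quasiMeasurePreserving_fst.ae hF] with z hz using mul_alloc_mem M hz

theorem integrable_cost_alloc (F : Measure ℝ) [IsProbabilityMeasure F]
    (hG : ∀ᵐ c ∂G, c ∈ Icc 0 b) (M : Mechanism) :
    Integrable (fun z : ℝ × ℝ => z.2 * M.alloc z.1 z.2) (F.prod G) := by
  refine integrable_of_mem_Icc (a := 0) (b := b) (measurable_snd.mul M.measurable_alloc) ?_
  filter_upwards [Measure.quasiMeasurePreserving_snd.ae hG] with z hz using mul_alloc_mem M hz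

theorem buyerInterim_eq {r : ℝ} (h : Integrable (fun c => M.buyerPay r c) G) (v : ℝ) :
    buyerInterim G M v r = v * (∫ c, M.alloc r c ∂G) - ∫ c, M.buyerPay r c ∂G := by
  rw [buyerInterim, integral_sub ((integrable_alloc_right G M r).const_mul v) h,
    integral_const_mul]

theorem sellerInterim_eq {r : ℝ} (h : Integrable (fun v => M.sellerPay v r) F) (c : ℝ) :
    sellerInterim F M c r = (∫ v, M.sellerPay v r ∂F) - c * ∫ v, M.alloc v r ∂F := by
  rw [sellerInterim, integral_sub h ((integrable_alloc_left F M r).const_mul c),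
    integral_const_mul]

theorem buyerUtility_eq (hF : ∀ᵐ v ∂F, v ∈ Icc 0 b)
    (h : Integrable (Function.uncurry M.buyerPay) (F.prod G)) :
    buyerUtility F G M = (∫ z : ℝ × ℝ, z.1 * M.alloc z.1 z.2 ∂(F.prod G)) -
      ∫ z : ℝ × ℝ, M.buyerPay z.1 z.2 ∂(F.prod G) := by
  have h' : Integrable (fun z : ℝ × ℝ => M.buyerPay z.1 z.2) (F.prod G) := h
  rw [← integral_sub (integrable_value_alloc G hF M) h']
  exact (integral_prod _ ((integrable_value_alloc G hF M).sub h)).symm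

theorem sellerUtility_eq (hG : ∀ᵐ c ∂G, c ∈ Icc 0 b)
    (h : Integrable (Function.uncurry M.sellerPay) (F.prod G)) :
    sellerUtility F G M = (∫ z : ℝ × ℝ, M.sellerPay z.1 z.2 ∂(F.prod G)) -
      ∫ z : ℝ × ℝ, z.2 * M.alloc z.1 z.2 ∂(F.prod G) := by
  have h' : Integrable (fun z : ℝ × ℝ => M.sellerPay z.1 z.2) (F.prod G) := h
  rw [← integral_sub h' (integrable_cost_alloc F hG M)]
  exact (integral_prod_symm _ (h.sub (integrable_cost_alloc F hG M))).symm

theorem gft_eq (hF : ∀ᵐ v ∂F, v ∈ Icc 0 b) (hG : ∀ᵐ c ∂G, c ∈ Icc 0 b) (M : Mechanism) :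
    gft F G M = (∫ z : ℝ × ℝ, z.1 * M.alloc z.1 z.2 ∂(F.prod G)) -
      ∫ z : ℝ × ℝ, z.2 * M.alloc z.1 z.2 ∂(F.prod G) := by
  rw [← integral_sub (integrable_value_alloc G hF M) (integrable_cost_alloc F hG M), gft]
  simp only [sub_mul]

theorem IsTruthful.budget_prod (hM : IsTruthful F G M) :
    ∫ z : ℝ × ℝ, M.sellerPay z.1 z.2 ∂(F.prod G) ≤
      ∫ z : ℝ × ℝ, M.buyerPay z.1 z.2 ∂(F.prod G) := by
  have h1 := integral_prod_symm _ hM.integrable_sellerPay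
  have h2 := integral_prod _ hM.integrable_buyerPay
  simp only [Function.uncurry_def] at h1 h2
  rw [h1, h2]
  exact hM.budget

/-! ### Offers -/

/-- The buyer faces a price independent of the bid, so truth is optimal against each `c`. A
misreport of the seller merely posts another type's price, which optimality of the own price covers.
-/
theorem isTruthful_sellerOffer (hF : ∀ᵐ v ∂F, v ∈ Icc 0 b) (hG : ∀ᵐ c ∂G, c ∈ Icc 0 b)
    (o : SellerOffer F G) : IsTruthful F G o.mechanism := by
  have hpay : ∀ v c, 0 ≤ v → o.mechanism.buyerPay v c ∈ Icc 0 v := by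
    intro v c hv
    simp only [SellerOffer.mechanism]
    split_ifs with h
    · exact ⟨o.price_nonneg c, h⟩
    · exact ⟨le_rfl, hv⟩
  have hpay' : ∀ v c, v ∈ Icc 0 b → o.mechanism.buyerPay v c ∈ Icc 0 b := fun v c hv =>
    ⟨(hpay v c hv.1).1, (hpay v c hv.1).2.trans hv.2⟩
  have hint : Integrable (Function.uncurry o.mechanism.buyerPay) (F.prod G) := by
    refine integrable_of_mem_Icc o.mechanism.measurable_buyerPay (a := 0) (b := b) ?_
    filter_upwards [Measure.quasiMeasurePreserving_fst.ae hF] with z hz using hpay' _ _ hz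
  have hbid : ∀ r, 0 ≤ r → Integrable (fun c => o.mechanism.buyerPay r c) G := fun r hr =>
    integrable_of_mem_Icc (o.mechanism.measurable_buyerPay.comp measurable_prodMk_left)
      (ae_of_all _ fun c => hpay r c hr)
  refine ⟨hint, hint, hbid, fun r _ => ?_, fun v hv r hr => ?_, fun c hc r _ => ?_,
    fun v _ => ?_, fun c hc => ?_, (integral_integral_swap hint).ge⟩
  · refine integrable_of_mem_Icc (a := 0) (b := b)
      (o.mechanism.measurable_sellerPay.comp measurable_prodMk_right) ?_
    filter_upwards [hF] with v hv using hpay' v r hv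
  · refine integral_mono (((integrable_alloc_right G _ r).const_mul v).sub (hbid r hr))
      (((integrable_alloc_right G _ v).const_mul v).sub
        (hbid v (IsPrior.support_subset hF hv).1)) fun c => ?_
    simp only [SellerOffer.mechanism]
    split_ifs <;> linarith
  · rw [sellerInterim_sellerOffer, sellerInterim_sellerOffer]
    exact o.optimal c hc _ (o.price_nonneg r)
  · refine integral_nonneg fun c => ?_
    simp only [SellerOffer.mechanism, Pi.zero_apply]
    split_ifs <;> linarith
  · rw [sellerInterim_sellerOffer]
    simpa using o.optimal c hc c (IsPrior.support_subset hG hc).1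

theorem isTruthful_buyerOffer (hF : ∀ᵐ v ∂F, v ∈ Icc 0 b) (hG : ∀ᵐ c ∂G, c ∈ Icc 0 b)
    (o : BuyerOffer F G) : IsTruthful F G o.mechanism := by
  have hpay : ∀ v c, o.mechanism.buyerPay v c ∈ Icc 0 (o.price v) := by
    intro v c
    simp only [BuyerOffer.mechanism]
    split_ifs with h
    · exact ⟨o.price_nonneg v, le_rfl⟩
    · exact ⟨le_rfl, o.price_nonneg v⟩
  have hpay' : ∀ v c, v ∈ F.support → o.mechanism.buyerPay v c ∈ Icc 0 b := fun v c hv =>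
    ⟨(hpay v c).1, (hpay v c).2.trans (o.price_le hF hG hv)⟩
  have hsupp : ∀ᵐ v ∂F, v ∈ F.support := F.support_mem_ae
  have hint : Integrable (Function.uncurry o.mechanism.buyerPay) (F.prod G) := by
    refine integrable_of_mem_Icc o.mechanism.measurable_buyerPay (a := 0) (b := b) ?_
    filter_upwards [Measure.quasiMeasurePreserving_fst.ae hsupp] with z hz using hpay' _ _ hz
  have hbid : ∀ r, Integrable (fun v => o.mechanism.sellerPay v r) F := by
    intro r
    refine integrable_of_mem_Icc (a := 0) (b := b)
      (o.mechanism.measurable_sellerPay.comp measurable_prodMk_right) ?_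
    filter_upwards [hsupp] with v hv using hpay' v r hv
  refine ⟨hint, hint, fun r _ => ?_, fun r _ => hbid r, fun v hv r _ => ?_, fun c hc r hr => ?_,
    fun v hv => ?_, fun c _ => ?_, (integral_integral_swap hint).ge⟩
  · exact integrable_of_mem_Icc (o.mechanism.measurable_buyerPay.comp measurable_prodMk_left)
      (ae_of_all _ fun c => hpay r c)
  · rw [buyerInterim_buyerOffer, buyerInterim_buyerOffer]
    exact o.optimal v hv _ (o.price_nonneg r)
  · refine integral_mono ((hbid r).sub ((integrable_alloc_left F _ r).const_mul c))
      ((hbid c).sub ((integrable_alloc_left F _ c).const_mul c)) fun v => ?_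
    simp only [BuyerOffer.mechanism]
    split_ifs <;> linarith
  · rw [buyerInterim_buyerOffer]
    simpa using o.optimal v hv v (IsPrior.support_subset hF hv).1
  · refine integral_nonneg fun v => ?_
    simp only [BuyerOffer.mechanism, Pi.zero_apply]
    split_ifs <;> linarith

/-! ### Mixtures -/

theorem integral_mix {α : Type*} [MeasurableSpace α] {μ : Measure α} {f g : α → ℝ} (t : ℝ)
    (hf : Integrable f μ) (hg : Integrable g μ) :
    ∫ x, (t * f x + (1 - t) * g x) ∂μ = t * (∫ x, f x ∂μ) + (1 - t) * ∫ x, g x ∂μ := by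
  rw [integral_add (hf.const_mul t) (hg.const_mul (1 - t)), integral_const_mul,
    integral_const_mul]

theorem integrable_mix {α : Type*} [MeasurableSpace α] {μ : Measure α} {f g : α → ℝ} (t : ℝ)
    (hf : Integrable f μ) (hg : Integrable g μ) :
    Integrable (fun x => t * f x + (1 - t) * g x) μ :=
  (hf.const_mul t).add (hg.const_mul (1 - t))

theorem buyerInterim_mix (t : unitInterval) {r : ℝ} (hM : Integrable (fun c => M.buyerPay r c) G)
    (hN : Integrable (fun c => N.buyerPay r c) G) (v : ℝ) :
    buyerInterim G (Mechanism.mix t M N) v r =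
      t * buyerInterim G M v r + (1 - t) * buyerInterim G N v r := by
  rw [buyerInterim_eq hM, buyerInterim_eq hN,
    buyerInterim_eq (M := Mechanism.mix t M N) (integrable_mix t hM hN)]
  simp only [Mechanism.mix]
  rw [integral_mix _ hM hN,
    integral_mix _ (integrable_alloc_right G M r) (integrable_alloc_right G N r)]
  ring

theorem sellerInterim_mix (t : unitInterval) {r : ℝ}
    (hM : Integrable (fun v => M.sellerPay v r) F)
    (hN : Integrable (fun v => N.sellerPay v r) F) (c : ℝ) :
    sellerInterim F (Mechanism.mix t M N) c r =
      t * sellerInterim F M c r + (1 - t) * sellerInterim F N c r := by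
  rw [sellerInterim_eq hM, sellerInterim_eq hN,
    sellerInterim_eq (M := Mechanism.mix t M N) (integrable_mix t hM hN)]
  simp only [Mechanism.mix]
  rw [integral_mix _ hM hN,
    integral_mix _ (integrable_alloc_left F M r) (integrable_alloc_left F N r)]
  ring

theorem integral_value_alloc_mix (hF : ∀ᵐ v ∂F, v ∈ Icc 0 b) (t : unitInterval) :
    ∫ z : ℝ × ℝ, z.1 * (Mechanism.mix t M N).alloc z.1 z.2 ∂(F.prod G) =
      t * (∫ z : ℝ × ℝ, z.1 * M.alloc z.1 z.2 ∂(F.prod G)) +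
        (1 - t) * ∫ z : ℝ × ℝ, z.1 * N.alloc z.1 z.2 ∂(F.prod G) := by
  rw [← integral_mix _ (integrable_value_alloc G hF M) (integrable_value_alloc G hF N)]
  congr 1
  funext z
  simp only [Mechanism.mix]
  ring

theorem integral_cost_alloc_mix (hG : ∀ᵐ c ∂G, c ∈ Icc 0 b) (t : unitInterval) :
    ∫ z : ℝ × ℝ, z.2 * (Mechanism.mix t M N).alloc z.1 z.2 ∂(F.prod G) =
      t * (∫ z : ℝ × ℝ, z.2 * M.alloc z.1 z.2 ∂(F.prod G)) +
        (1 - t) * ∫ z : ℝ × ℝ, z.2 * N.alloc z.1 z.2 ∂(F.prod G) := by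
  rw [← integral_mix _ (integrable_cost_alloc F hG M) (integrable_cost_alloc F hG N)]
  congr 1
  funext z
  simp only [Mechanism.mix]
  ring

theorem IsTruthful.buyerUtility_mix (hF : ∀ᵐ v ∂F, v ∈ Icc 0 b) (hM : IsTruthful F G M)
    (hN : IsTruthful F G N) (t : unitInterval) :
    buyerUtility F G (Mechanism.mix t M N) =
      t * buyerUtility F G M + (1 - t) * buyerUtility F G N := by
  have h : ∫ z : ℝ × ℝ, (Mechanism.mix t M N).buyerPay z.1 z.2 ∂(F.prod G) =
      t * (∫ z : ℝ × ℝ, M.buyerPay z.1 z.2 ∂(F.prod G)) +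
        (1 - t) * ∫ z : ℝ × ℝ, N.buyerPay z.1 z.2 ∂(F.prod G) :=
    integral_mix _ hM.integrable_buyerPay hN.integrable_buyerPay
  rw [buyerUtility_eq hF hM.integrable_buyerPay, buyerUtility_eq hF hN.integrable_buyerPay,
    buyerUtility_eq hF (M := Mechanism.mix t M N)
      (integrable_mix t hM.integrable_buyerPay hN.integrable_buyerPay), integral_value_alloc_mix hF, h]
  ring

theorem IsTruthful.sellerUtility_mix (hG : ∀ᵐ c ∂G, c ∈ Icc 0 b) (hM : IsTruthful F G M)
    (hN : IsTruthful F G N) (t : unitInterval) :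
    sellerUtility F G (Mechanism.mix t M N) =
      t * sellerUtility F G M + (1 - t) * sellerUtility F G N := by
  have h : ∫ z : ℝ × ℝ, (Mechanism.mix t M N).sellerPay z.1 z.2 ∂(F.prod G) =
      t * (∫ z : ℝ × ℝ, M.sellerPay z.1 z.2 ∂(F.prod G)) +
        (1 - t) * ∫ z : ℝ × ℝ, N.sellerPay z.1 z.2 ∂(F.prod G) :=
    integral_mix _ hM.integrable_sellerPay hN.integrable_sellerPay
  rw [sellerUtility_eq hG hM.integrable_sellerPay, sellerUtility_eq hG hN.integrable_sellerPay,
    sellerUtility_eq hG (M := Mechanism.mix t M N)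
      (integrable_mix t hM.integrable_sellerPay hN.integrable_sellerPay), integral_cost_alloc_mix hG, h]
  ring

theorem IsTruthful.mix (hF : ∀ᵐ v ∂F, v ∈ Icc 0 b) (hG : ∀ᵐ c ∂G, c ∈ Icc 0 b)
    (hM : IsTruthful F G M) (hN : IsTruthful F G N) (t : unitInterval) :
    IsTruthful F G (Mechanism.mix t M N) := by
  have ht0 : (0 : ℝ) ≤ t := t.2.1
  have ht1 : (0 : ℝ) ≤ 1 - t := sub_nonneg.2 t.2.2
  have hb := fun v r (hr : 0 ≤ r) => buyerInterim_mix t (hM.integrable_buyerPay_bid r hr)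
    (hN.integrable_buyerPay_bid r hr) v
  have hs := fun c r (hr : 0 ≤ r) => sellerInterim_mix t (hM.integrable_sellerPay_bid r hr)
    (hN.integrable_sellerPay_bid r hr) c
  have hbuy : Integrable (Function.uncurry (Mechanism.mix t M N).buyerPay) (F.prod G) :=
    integrable_mix t hM.integrable_buyerPay hN.integrable_buyerPay
  have hsell : Integrable (Function.uncurry (Mechanism.mix t M N).sellerPay) (F.prod G) :=
    integrable_mix t hM.integrable_sellerPay hN.integrable_sellerPay
  refine ⟨hbuy, hsell,
    fun r hr => integrable_mix t (hM.integrable_buyerPay_bid r hr)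
      (hN.integrable_buyerPay_bid r hr),
    fun r hr => integrable_mix t (hM.integrable_sellerPay_bid r hr)
      (hN.integrable_sellerPay_bid r hr),
    fun v hv r hr => ?_, fun c hc r hr => ?_, fun v hv => ?_, fun c hc => ?_, ?_⟩
  · rw [hb v r hr, hb v v (IsPrior.support_subset hF hv).1]
    exact add_le_add (mul_le_mul_of_nonneg_left (hM.buyer_ic v hv r hr) ht0)
      (mul_le_mul_of_nonneg_left (hN.buyer_ic v hv r hr) ht1)
  · rw [hs c r hr, hs c c (IsPrior.support_subset hG hc).1]
    exact add_le_add (mul_le_mul_of_nonneg_left (hM.seller_ic c hc r hr) ht0)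
      (mul_le_mul_of_nonneg_left (hN.seller_ic c hc r hr) ht1)
  · rw [hb v v (IsPrior.support_subset hF hv).1]
    exact add_nonneg (mul_nonneg ht0 (hM.buyer_ir v hv)) (mul_nonneg ht1 (hN.buyer_ir v hv))
  · rw [hs c c (IsPrior.support_subset hG hc).1]
    exact add_nonneg (mul_nonneg ht0 (hM.seller_ir c hc)) (mul_nonneg ht1 (hN.seller_ir c hc))
  · have h1 := integral_prod_symm _ hsell
    have h2 := integral_prod _ hbuy
    have h3 := integral_mix (t : ℝ) hM.integrable_sellerPay hN.integrable_sellerPay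
    have h4 := integral_mix (t : ℝ) hM.integrable_buyerPay hN.integrable_buyerPay
    exact (h1.symm.trans h3).trans_le ((add_le_add
      (mul_le_mul_of_nonneg_left hM.budget_prod ht0)
      (mul_le_mul_of_nonneg_left hN.budget_prod ht1)).trans (h4.symm.trans h2).le)

end Mechanism

/-! ### Ideal utilities and the second best -/

theorem IsTruthful.buyerUtility_nonneg {F G : Measure ℝ} {M : Mechanism} (hM : IsTruthful F G M) :
    0 ≤ buyerUtility F G M := by
  refine integral_nonneg_of_ae ?_
  have hs : ∀ᵐ v ∂F, v ∈ F.support := F.support_mem_ae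
  filter_upwards [hs] with v hv using hM.buyer_ir v hv

theorem IsTruthful.sellerUtility_nonneg {F G : Measure ℝ} {M : Mechanism} (hM : IsTruthful F G M) :
    0 ≤ sellerUtility F G M := by
  refine integral_nonneg_of_ae ?_
  have hs : ∀ᵐ c ∂G, c ∈ G.support := G.support_mem_ae
  filter_upwards [hs] with c hc using hM.seller_ir c hc

section Bounds

variable {F G : Measure ℝ} [IsProbabilityMeasure F] [IsProbabilityMeasure G] {b : ℝ}
  {M : Mechanism}

/-- No truthful mechanism leaves more to the seller than the seller-offer mechanism, even if the
whole budget surplus is handed to the seller. -/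
theorem IsTruthful.revenue_sub_cost_le (hb : 0 ≤ b) (hF : ∀ᵐ v ∂F, v ∈ Icc 0 b)
    (hG : ∀ᵐ c ∂G, c ∈ Icc 0 b) (hM : IsTruthful F G M) (s : SellerOffer F G) :
    (∫ z : ℝ × ℝ, M.buyerPay z.1 z.2 ∂(F.prod G)) -
      ∫ z : ℝ × ℝ, z.2 * M.alloc z.1 z.2 ∂(F.prod G) ≤ sellerUtility F G s.mechanism := by
  have hFs := IsPrior.support_subset hF
  have hsT := isTruthful_sellerOffer hF hG s
  have hmeas : Measurable fun c => sellerInterim F s.mechanism c c :=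
    StronglyMeasurable.measurable (StronglyMeasurable.integral_prod_left (μ := F)
      (f := fun v c => s.mechanism.sellerPay v c - c * s.mechanism.alloc v c)
      (s.mechanism.measurable_sellerPay.sub
        (measurable_snd.mul s.mechanism.measurable_alloc)).stronglyMeasurable)
  have hint : Integrable (fun c => sellerInterim F s.mechanism c c) G :=
    (hsT.integrable_sellerPay.sub (integrable_cost_alloc F hG s.mechanism)).integral_prod_right
  have h := integral_payment_sub_cost_le (μ := F) (ν := G) (S := F.support) (V := fun v => v)
    (P := fun v => ∫ c, M.buyerPay v c ∂G) (C := fun c => c) (x := M.alloc)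
    (R := fun c => sellerInterim F s.mechanism c c) (K := G.support) hb F.support_mem_ae
    (fun a ha => hFs ha) measurable_id hG M.measurable_alloc M.alloc_mem
    hM.integrable_buyerPay.integral_prod_left
    (fun a ha r hr => by
      have h := hM.buyer_ic a ha r (hFs hr).1
      rwa [buyerInterim_eq (hM.integrable_buyerPay_bid r (hFs hr).1),
        buyerInterim_eq (hM.integrable_buyerPay_bid a (hFs ha).1)] at h)
    (fun a ha => by
      have h := hM.buyer_ir a ha
      rwa [buyerInterim_eq (hM.integrable_buyerPay_bid a (hFs ha).1)] at h)
    Measure.isClosed_support.measurableSet G.support_mem_ae hmeas hint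
    (fun c hc p hp => by
      rw [sellerInterim_sellerOffer]
      exact s.optimal c hc p hp.1)
  have h1 := integral_prod _ hM.integrable_buyerPay
  have h2 := integral_prod _ (integrable_cost_alloc F hG M)
  simp only [Function.uncurry_def] at h1
  rw [h1, h2]
  exact h

/-- No truthful mechanism leaves more to the buyer than the buyer-offer mechanism, even if the
whole budget surplus is handed to the buyer. -/
theorem IsTruthful.value_sub_payment_le (hb : 0 ≤ b) (hF : ∀ᵐ v ∂F, v ∈ Icc 0 b)
    (hG : ∀ᵐ c ∂G, c ∈ Icc 0 b) (hM : IsTruthful F G M) (o : BuyerOffer F G) :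
    (∫ z : ℝ × ℝ, z.1 * M.alloc z.1 z.2 ∂(F.prod G)) -
      ∫ z : ℝ × ℝ, M.sellerPay z.1 z.2 ∂(F.prod G) ≤ buyerUtility F G o.mechanism := by
  have hGs := IsPrior.support_subset hG
  have hoT := isTruthful_buyerOffer hF hG o
  have hmeas : Measurable fun v => buyerInterim G o.mechanism v v :=
    StronglyMeasurable.measurable (StronglyMeasurable.integral_prod_right (ν := G)
      (f := fun v c => v * o.mechanism.alloc v c - o.mechanism.buyerPay v c)
      ((measurable_fst.mul o.mechanism.measurable_alloc).sub
        o.mechanism.measurable_buyerPay).stronglyMeasurable)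
  have hint : Integrable (fun v => buyerInterim G o.mechanism v v) F :=
    ((integrable_value_alloc G hF o.mechanism).sub hoT.integrable_buyerPay).integral_prod_left
  -- The reflection `y ↦ b - y` exchanges the roles: the seller becomes a buyer of value `b - c` who
  -- pays `b x - p̃`, with unchanged utility, and the buyer becomes a supplier of cost `b - v`.
  -- Posting `p` there means offering `b - p` here.
  have hreflect : ∀ y ∈ Icc 0 b, b - y ∈ Icc 0 b := fun y hy =>
    ⟨sub_nonneg.2 hy.2, sub_le_self b hy.1⟩
  have hA : Integrable (fun c => ∫ v, M.alloc v c ∂F) G :=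
    (integrable_alloc F G M).integral_prod_right
  have hS : Integrable (fun c => ∫ v, M.sellerPay v c ∂F) G :=
    hM.integrable_sellerPay.integral_prod_right
  have hutil : ∀ a ∈ G.support, ∀ r ∈ G.support,
      (b - a) * (∫ v, M.alloc v r ∂F) - (b * (∫ v, M.alloc v r ∂F) - ∫ v, M.sellerPay v r ∂F) =
        sellerInterim F M a r := by
    intro a _ r hr
    rw [sellerInterim_eq (hM.integrable_sellerPay_bid r (hGs hr).1)]
    ring
  have h := integral_payment_sub_cost_le (μ := G) (ν := F) (S := G.support)
    (V := fun c => b - c) (P := fun c => b * (∫ v, M.alloc v c ∂F) - ∫ v, M.sellerPay v c ∂F)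
    (C := fun v => b - v) (x := fun c v => M.alloc v c)
    (R := fun y => buyerInterim G o.mechanism (b - y) (b - y))
    (K := (fun y => b - y) ⁻¹' F.support) hb G.support_mem_ae
    (fun a ha => hreflect a (hGs ha)) (measurable_const.sub measurable_id)
    (by filter_upwards [hF] with v hv using hreflect v hv)
    (M.measurable_alloc.comp measurable_swap) (fun a c => M.alloc_mem c a)
    ((hA.const_mul b).sub hS)
    (fun a ha r hr => by
      rw [hutil a ha r hr, hutil a ha a ha]
      exact hM.seller_ic a ha r (hGs hr).1)
    (fun a ha => by
      rw [hutil a ha a ha]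
      exact hM.seller_ir a ha)
    ((measurable_const.sub measurable_id) Measure.isClosed_support.measurableSet)
    (by
      have hs : ∀ᵐ v ∂F, v ∈ F.support := F.support_mem_ae
      filter_upwards [hs] with v hv
      simpa using hv)
    (hmeas.comp (measurable_const.sub measurable_id))
    (by simpa using hint)
    (fun y hy p hp => by
      rw [buyerInterim_buyerOffer]
      have h := o.optimal (b - y) hy (b - p) (hreflect p hp).1
      have hset : {a : ℝ | p ≤ b - a} = Iic (b - p) := by
        ext a
        simp only [mem_ofPred_eq, mem_Iic]
        constructor <;> intro h <;> linarith
      rw [hset]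
      linarith)
  simp only [sub_sub_cancel] at h
  have h1 := integral_prod_symm _ hM.integrable_sellerPay
  have h2 := integral_prod_symm _ (integrable_alloc F G M)
  have h3 : ∫ c, ∫ v, (b - v) * M.alloc v c ∂F ∂G =
      ∫ z : ℝ × ℝ, (b * M.alloc z.1 z.2 - z.1 * M.alloc z.1 z.2) ∂(F.prod G) := by
    have h4 : Integrable (fun z : ℝ × ℝ => b * M.alloc z.1 z.2 - z.1 * M.alloc z.1 z.2)
        (F.prod G) := ((integrable_alloc F G M).const_mul b).sub (integrable_value_alloc G hF M)
    rw [integral_prod_symm _ h4]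
    simp only [sub_mul]
  rw [integral_sub ((integrable_alloc F G M).const_mul b) (integrable_value_alloc G hF M),
    integral_const_mul] at h3
  rw [integral_sub (hA.const_mul b) hS, integral_const_mul, h3, ← h2] at h
  simp only [Function.uncurry_def] at h1
  rw [← h1] at h
  have hU : buyerUtility F G o.mechanism = ∫ v, buyerInterim G o.mechanism v v ∂F := rfl
  rw [hU]
  linarith

theorem IsTruthful.sellerUtility_le (hb : 0 ≤ b) (hF : ∀ᵐ v ∂F, v ∈ Icc 0 b)
    (hG : ∀ᵐ c ∂G, c ∈ Icc 0 b) (hM : IsTruthful F G M) (s : SellerOffer F G) :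
    sellerUtility F G M ≤ sellerUtility F G s.mechanism := by
  have h := hM.revenue_sub_cost_le hb hF hG s
  rw [sellerUtility_eq hG hM.integrable_sellerPay]
  linarith [hM.budget_prod]

theorem IsTruthful.buyerUtility_le (hb : 0 ≤ b) (hF : ∀ᵐ v ∂F, v ∈ Icc 0 b)
    (hG : ∀ᵐ c ∂G, c ∈ Icc 0 b) (hM : IsTruthful F G M) (o : BuyerOffer F G) :
    buyerUtility F G M ≤ buyerUtility F G o.mechanism := by
  have h := hM.value_sub_payment_le hb hF hG o
  rw [buyerUtility_eq hF hM.integrable_buyerPay]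
  linarith [hM.budget_prod]

theorem sellerIdeal_eq (hb : 0 ≤ b) (hF : ∀ᵐ v ∂F, v ∈ Icc 0 b) (hG : ∀ᵐ c ∂G, c ∈ Icc 0 b)
    (s : SellerOffer F G) : sellerIdeal F G = sellerUtility F G s.mechanism := by
  refine IsGreatest.csSup_eq ⟨⟨_, isTruthful_sellerOffer hF hG s, rfl⟩, ?_⟩
  rintro _ ⟨M, hM, rfl⟩
  exact IsTruthful.sellerUtility_le hb hF hG hM s

theorem buyerIdeal_eq (hb : 0 ≤ b) (hF : ∀ᵐ v ∂F, v ∈ Icc 0 b) (hG : ∀ᵐ c ∂G, c ∈ Icc 0 b)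
    (o : BuyerOffer F G) : buyerIdeal F G = buyerUtility F G o.mechanism := by
  refine IsGreatest.csSup_eq ⟨⟨_, isTruthful_buyerOffer hF hG o, rfl⟩, ?_⟩
  rintro _ ⟨M, hM, rfl⟩
  exact IsTruthful.buyerUtility_le hb hF hG hM o

/-- A weakly balanced mechanism may waste money, so its gains from trade can exceed the sum of the
utilities. Bounding the buyer's payment minus the cost, rather than the seller's utility, covers the
wasted part. -/
theorem secondBest_le (hb : 0 ≤ b) (hF : ∀ᵐ v ∂F, v ∈ Icc 0 b) (hG : ∀ᵐ c ∂G, c ∈ Icc 0 b)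
    (s : SellerOffer F G) (o : BuyerOffer F G) :
    secondBest F G ≤ sellerUtility F G s.mechanism + buyerUtility F G o.mechanism := by
  refine csSup_le ⟨_, noTrade, isTruthful_noTrade F G, rfl⟩ ?_
  rintro _ ⟨M, hM, rfl⟩
  have h1 := IsTruthful.revenue_sub_cost_le hb hF hG hM s
  have h2 := IsTruthful.buyerUtility_le hb hF hG hM o
  rw [buyerUtility_eq hF hM.integrable_buyerPay] at h2
  rw [gft_eq hF hG]
  linarith

theorem gft_eq_add (hF : ∀ᵐ v ∂F, v ∈ Icc 0 b) (hG : ∀ᵐ c ∂G, c ∈ Icc 0 b)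
    (hM : IsTruthful F G M) (hpay : M.buyerPay = M.sellerPay) :
    gft F G M = sellerUtility F G M + buyerUtility F G M := by
  rw [gft_eq hF hG, sellerUtility_eq hG hM.integrable_sellerPay,
    buyerUtility_eq hF hM.integrable_buyerPay, hpay]
  ring

end Bounds

/-! ### The equalizing weight -/

/-- Mixing the two ideal outcomes so as to equalize the relative utilities leaves each trader at
least half of the ideal utility. -/
theorem exists_fair_weight {p u πB uS : ℝ} (hp : 0 < p) (hu : 0 < u) (hπ0 : 0 ≤ πB)
    (hπ : πB ≤ p) (hS0 : 0 ≤ uS) (hS : uS ≤ u) :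
    ∃ t : unitInterval, (t * p + (1 - t) * πB) / p = (t * uS + (1 - t) * u) / u ∧
      1 / 2 * (p + u) ≤ (t * p + (1 - t) * πB) + (t * uS + (1 - t) * u) := by
  obtain ⟨t, ht⟩ : ∃ t : unitInterval,
      (t * p + (1 - t) * πB) / p - (t * uS + (1 - t) * u) / u = 0 := by
    have hcont : Continuous fun t : unitInterval =>
        ((t : ℝ) * p + (1 - t) * πB) / p - (t * uS + (1 - t) * u) / u := by fun_prop
    -- At weight `0` the buyer has the full ideal and the difference is `πB / p - 1 ≤ 0`; at weight
    -- `1` the seller has it and the difference is `1 - uS / u ≥ 0`.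
    refine mem_range_of_exists_le_of_exists_ge hcont ⟨0, ?_⟩ ⟨1, ?_⟩
    · have h1 : u / u = 1 := div_self hu.ne'
      have h2 : πB / p ≤ 1 := (div_le_one hp).2 hπ
      simp only [Icc.coe_zero, zero_mul, zero_add, sub_zero, one_mul]
      linarith
    · have h1 : p / p = 1 := div_self hp.ne'
      have h2 : uS / u ≤ 1 := (div_le_one hu).2 hS
      simp only [Icc.coe_one, sub_self, zero_mul, add_zero, one_mul]
      linarith
  refine ⟨t, sub_eq_zero.1 ht, ?_⟩
  have ht0 : (0 : ℝ) ≤ t := t.2.1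
  have ht1 : (0 : ℝ) ≤ 1 - t := sub_nonneg.2 t.2.2
  set r := (t * p + (1 - t) * πB) / p with hr
  have hr' : r = (t * uS + (1 - t) * u) / u := sub_eq_zero.1 ht
  have h1 : t * p + (1 - t) * πB = r * p := by rw [hr, div_mul_cancel₀ _ hp.ne']
  have h2 : t * uS + (1 - t) * u = r * u := by rw [hr', div_mul_cancel₀ _ hu.ne']
  -- The common ratio is at least `t` by the seller's own offers and at least `1 - t` by the
  -- buyer's, hence at least one half.
  have h3 : (t : ℝ) ≤ r := (le_div_iff₀ hp).2 (by linarith [mul_nonneg ht1 hπ0])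
  have h4 : 1 - (t : ℝ) ≤ r := by
    rw [hr']
    exact (le_div_iff₀ hu).2 (by linarith [mul_nonneg ht0 hS0])
  have h5 : 1 / 2 ≤ r := by linarith
  rw [h1, h2, ← mul_add]
  exact mul_le_mul_of_nonneg_right h5 (add_pos hp hu).le

/-! ### Instances without gains from trade -/

section NoGains

variable {F G : Measure ℝ} [IsProbabilityMeasure F] [IsProbabilityMeasure G] {b : ℝ}

/-- For almost every `c` the best profit is zero, so each price above `c` sells with probability
zero. Countably many rational prices then show `v ≤ c` almost surely. -/
theorem gft_nonpos_of_sellerUtility_eq_zero (hF : ∀ᵐ v ∂F, v ∈ Icc 0 b)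
    (hG : ∀ᵐ c ∂G, c ∈ Icc 0 b) (s : SellerOffer F G)
    (h : sellerUtility F G s.mechanism = 0) (M : Mechanism) : gft F G M ≤ 0 := by
  have hT := isTruthful_sellerOffer hF hG s
  have hsupp : ∀ᵐ c ∂G, c ∈ G.support := G.support_mem_ae
  have hzero : (fun c => sellerInterim F s.mechanism c c) =ᵐ[G] 0 := by
    refine (integral_eq_zero_iff_of_nonneg_ae ?_ ?_).1 h
    · filter_upwards [hsupp] with c hc using hT.seller_ir c hc
    · exact (hT.integrable_sellerPay.sub
        (integrable_cost_alloc F hG s.mechanism)).integral_prod_right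
  have hint := (integrable_value_alloc G hF M).sub (integrable_cost_alloc F hG M)
  have hgft : gft F G M = ∫ c, ∫ v, (v * M.alloc v c - c * M.alloc v c) ∂F ∂G := by
    rw [gft]
    simp only [sub_mul]
    exact integral_prod_symm _ hint
  rw [hgft]
  refine integral_nonpos_of_ae ?_
  filter_upwards [hsupp, hzero] with c hc hcz
  have hle : ∀ᵐ v ∂F, ∀ q : ℚ, c < q → ¬ (q : ℝ) ≤ v := by
    refine ae_all_iff.2 fun q => ?_
    by_cases hq : c < q
    · have hc0 := (IsPrior.support_subset hG hc).1
      have h1 := s.optimal c hc q (hc0.trans hq.le)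
      rw [← sellerInterim_sellerOffer, hcz, Pi.zero_apply] at h1
      have h2 : F.real (Ici (q : ℝ)) = 0 :=
        le_antisymm (nonpos_of_mul_nonpos_right h1 (sub_pos.2 hq)) measureReal_nonneg
      have h3 : F (Ici (q : ℝ)) = 0 := (measureReal_eq_zero_iff).1 h2
      have h4 : ∀ᵐ v ∂F, v ∉ Ici (q : ℝ) := measure_eq_zero_iff_ae_notMem.1 h3
      filter_upwards [h4] with v hv _ using hv
    · exact ae_of_all _ fun v h => absurd h hq
  refine integral_nonpos_of_ae ?_
  filter_upwards [hle] with v hv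
  have hvc : v ≤ c := by
    by_contra hlt
    obtain ⟨q, hq1, hq2⟩ := exists_rat_btwn (not_le.1 hlt)
    exact hv q hq1 hq2.le
  simpa using mul_le_mul_of_nonneg_right hvc (M.alloc_mem v c).1

theorem gft_nonpos_of_buyerUtility_eq_zero (hF : ∀ᵐ v ∂F, v ∈ Icc 0 b)
    (hG : ∀ᵐ c ∂G, c ∈ Icc 0 b) (o : BuyerOffer F G)
    (h : buyerUtility F G o.mechanism = 0) (M : Mechanism) : gft F G M ≤ 0 := by
  have hT := isTruthful_buyerOffer hF hG o
  have hsupp : ∀ᵐ v ∂F, v ∈ F.support := F.support_mem_ae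
  have hzero : (fun v => buyerInterim G o.mechanism v v) =ᵐ[F] 0 := by
    refine (integral_eq_zero_iff_of_nonneg_ae ?_ ?_).1 h
    · filter_upwards [hsupp] with v hv using hT.buyer_ir v hv
    · exact ((integrable_value_alloc G hF o.mechanism).sub
        hT.integrable_buyerPay).integral_prod_left
  have hint := (integrable_value_alloc G hF M).sub (integrable_cost_alloc F hG M)
  have hgft : gft F G M = ∫ v, ∫ c, (v * M.alloc v c - c * M.alloc v c) ∂G ∂F := by
    rw [gft]
    simp only [sub_mul]
    exact integral_prod _ hint
  rw [hgft]
  refine integral_nonpos_of_ae ?_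
  filter_upwards [hsupp, hzero] with v hv hvz
  -- Optimality is known only against nonnegative offers; this suffices because `c ≥ 0` almost
  -- surely, so a rational between `c` and `v` is nonnegative.
  have hle : ∀ᵐ c : ℝ ∂G, ∀ q : ℚ, 0 ≤ (q : ℝ) → (q : ℝ) < v → ¬ c ≤ q := by
    refine ae_all_iff.2 fun q => ?_
    by_cases hq : 0 ≤ (q : ℝ) ∧ (q : ℝ) < v
    · have h1 := o.optimal v hv q hq.1
      rw [← buyerInterim_buyerOffer, hvz, Pi.zero_apply] at h1
      have h2 : G.real (Iic (q : ℝ)) = 0 :=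
        le_antisymm (nonpos_of_mul_nonpos_right h1 (sub_pos.2 hq.2)) measureReal_nonneg
      have h3 : G (Iic (q : ℝ)) = 0 := (measureReal_eq_zero_iff).1 h2
      have h4 : ∀ᵐ c ∂G, c ∉ Iic (q : ℝ) := measure_eq_zero_iff_ae_notMem.1 h3
      filter_upwards [h4] with c hc _ _ using hc
    · exact ae_of_all _ fun c h1 h2 => absurd ⟨h1, h2⟩ hq
  refine integral_nonpos_of_ae ?_
  filter_upwards [hle, hG] with c hc hcb
  have hvc : v ≤ c := by
    by_contra hlt
    obtain ⟨q, hq1, hq2⟩ := exists_rat_btwn (not_le.1 hlt)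
    exact hc q (hcb.1.trans hq1.le) hq2 hq1.le
  simpa using mul_le_mul_of_nonneg_right hvc (M.alloc_mem v c).1

/-- The two ideal utilities vanish together. -/
theorem sellerUtility_eq_zero_iff (hF : ∀ᵐ v ∂F, v ∈ Icc 0 b) (hG : ∀ᵐ c ∂G, c ∈ Icc 0 b)
    (s : SellerOffer F G) (o : BuyerOffer F G) :
    sellerUtility F G s.mechanism = 0 ↔ buyerUtility F G o.mechanism = 0 := by
  have hs := isTruthful_sellerOffer hF hG s
  have ho := isTruthful_buyerOffer hF hG o
  constructor <;> intro h
  · have h1 := gft_nonpos_of_sellerUtility_eq_zero hF hG s h o.mechanism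
    rw [gft_eq_add hF hG ho rfl] at h1
    linarith [ho.buyerUtility_nonneg, ho.sellerUtility_nonneg]
  · have h1 := gft_nonpos_of_buyerUtility_eq_zero hF hG o h s.mechanism
    rw [gft_eq_add hF hG hs rfl] at h1
    linarith [hs.buyerUtility_nonneg, hs.sellerUtility_nonneg]

end NoGains

end BilateralTrade

/-! ### The main theorem -/

theorem mainTheorem1 (F G : MeasureTheory.Measure ℝ)
    (hF : BilateralTrade.IsPrior F) (hG : BilateralTrade.IsPrior G) :
    Nonempty (BilateralTrade.SellerOffer F G) ∧
    Nonempty (BilateralTrade.BuyerOffer F G) ∧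
    ∀ (s : BilateralTrade.SellerOffer F G) (b : BilateralTrade.BuyerOffer F G),
      ∃ t : unitInterval,
        BilateralTrade.IsKSFair F G (BilateralTrade.biasedRandomOffer t s b) ∧
        BilateralTrade.gft F G (BilateralTrade.biasedRandomOffer t s b) ≥
          (1 / 2 : ℝ) * BilateralTrade.secondBest F G := by
  open BilateralTrade in
  refine ⟨nonempty_sellerOffer hF hG, nonempty_buyerOffer hF hG, fun s o => ?_⟩
  have := hF.isProbabilityMeasure
  have := hG.isProbabilityMeasure
  obtain ⟨b₁, hb₁, hF₁⟩ := hF.exists_Icc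
  obtain ⟨b₂, -, hG₂⟩ := hG.exists_Icc
  have hb : 0 ≤ max b₁ b₂ := hb₁.trans (le_max_left _ _)
  have hFb : ∀ᵐ v ∂F, v ∈ Icc 0 (max b₁ b₂) := by
    filter_upwards [hF₁] with v hv using ⟨hv.1, hv.2.trans (le_max_left _ _)⟩
  have hGb : ∀ᵐ c ∂G, c ∈ Icc 0 (max b₁ b₂) := by
    filter_upwards [hG₂] with c hc using ⟨hc.1, hc.2.trans (le_max_right _ _)⟩
  have hsT := isTruthful_sellerOffer hFb hGb s
  have hoT := isTruthful_buyerOffer hFb hGb o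
  have hmixT := fun t => hsT.mix hFb hGb hoT t
  have hS := fun t => hsT.sellerUtility_mix hGb hoT t
  have hU := fun t => hsT.buyerUtility_mix hFb hoT t
  have hgft : ∀ t, gft F G (biasedRandomOffer t s o) =
      sellerUtility F G (biasedRandomOffer t s o) +
        buyerUtility F G (biasedRandomOffer t s o) :=
    fun t => gft_eq_add hFb hGb (hmixT t) rfl
  have hopt := secondBest_le hb hFb hGb s o
  suffices h : ∃ t : unitInterval,
      sellerUtility F G (biasedRandomOffer t s o) / sellerUtility F G s.mechanism =
        buyerUtility F G (biasedRandomOffer t s o) / buyerUtility F G o.mechanism ∧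
      1 / 2 * (sellerUtility F G s.mechanism + buyerUtility F G o.mechanism) ≤
        sellerUtility F G (biasedRandomOffer t s o) +
          buyerUtility F G (biasedRandomOffer t s o) by
    obtain ⟨t, ht, hle⟩ := h
    refine ⟨t, ⟨hmixT t, ?_⟩, ?_⟩
    · rw [sellerIdeal_eq hb hFb hGb s, buyerIdeal_eq hb hFb hGb o]
      exact ht
    · rw [hgft t, ge_iff_le]
      linarith
  have hzero := sellerUtility_eq_zero_iff hFb hGb s o
  rcases hsT.sellerUtility_nonneg.eq_or_lt with hp | hp
  · have hu := hzero.1 hp.symm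
    -- Any weight would do: both ideals vanish and both quotients are zero by convention.
    refine ⟨0, ?_, ?_⟩
    · rw [hu, ← hp, div_zero, div_zero]
    · rw [hu, ← hp]
      have h1 := (hmixT 0).sellerUtility_nonneg
      have h2 := (hmixT 0).buyerUtility_nonneg
      simp only [biasedRandomOffer]
      linarith
  · have hu : 0 < buyerUtility F G o.mechanism :=
      hoT.buyerUtility_nonneg.lt_of_ne fun h => hp.ne' (hzero.2 h.symm)
    obtain ⟨t, ht, hle⟩ := exists_fair_weight hp hu hoT.sellerUtility_nonneg
      (hoT.sellerUtility_le hb hFb hGb s) hsT.buyerUtility_nonneg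
      (hsT.buyerUtility_le hb hFb hGb o)
    refine ⟨t, ?_, ?_⟩
    · rw [biasedRandomOffer, hS t, hU t]
      exact ht
    · rw [biasedRandomOffer, hS t, hU t]
      exact hle
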